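/- **Model (swap-and-purify switch).** A switch serves $K$ users in slots $n=0,1,\dots$. In each slot the numbers $T_i(n)$ of link-level entanglements of the users $i$ are independent $\mathrm{Bin}(\alpha_{max},p_i)$ variables with $0<p_i<1$; they have values in $\mathcal A=\{0,\dots,\alpha_{max}\}^K$ and last for one slot. For a pair of users $i<j$, a swap succeeds with probability $q_{ij}\in[0,1]$. A purification protocol turns $X=x$ input pairs into a random number $Y\le x$ of output pairs with law $P_{Y|X}(\cdot|x)$. The request arrivals $A_{ij}(n)\in\{0,1,2,\dots\}$ are independent over pairs and i.i.d. over slots, with mean $\lambda_{ij}$. All these variables and the outcomes of swaps and purifications are independent. A scheduling policy picks, from the queue lengths $\mathbf Q(n)$ and $\mathbf T(n)=\mathbf a$, an allocation $\mathbf W(n)$; $W_{ij}(n)$ swaps consume $W_{ij}(n)$ entanglements of $i$ and of $j$, so $\sum_i W_{ij}(n)\le a_j$ for all $j$ (with $W_{ij}=W_{ji}$). Then $S_{ij}(n)=\min\{W_{ij}(n),Q_{ij}(n)\}$ swaps are attempted, $B_{ij}(n)\sim\mathrm{Bin}(S_{ij}(n),q_{ij})$ succeed, $D_{ij}(n)\sim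 P_{Y|X}(\cdot|B_{ij}(n))$ purified pairs are delivered, and $Q_{ij}(n+1)=Q_{ij}(n)-D_{ij}(n)+A_{ij}(n)$. Let $$\hat H(\pi_{ij})=\sum_{l=0}^{\pi_{ij}}\mathbb E[Y|X=l]\binom{\pi_{ij}}{l}q_{ij}^l(1-q_{ij})^{\pi_{ij}-l}.$$ The policy MW-SP chooses $\mathbf W(n)$ as a maximizer of $\sum_{i<j}\hat H(\pi_{ij})Q_{ij}(n)$ over the allocations $\pi$ with $\sum_i\pi_{ij}\le a_j$ for all $j$, with any fixed rule (a function of $\mathbf Q(n)$ and $\mathbf a$) for breaking ties. Let $\Lambda^{SP}$ be the set of vectors $\lambda\ge 0$ for which there are numbers $b_{\mathbf a,\pi}>0$ with $\sum_\pi b_{\mathbf a,\pi}<1$ for every $\mathbf a\in\mathcal A$ and $$\lambda_{ij}\le\sum_{\mathbf a\in\mathcal A,\,\mathbf a\ne 0}P_{\mathbf T}(\mathbf a)\sum_{\pi:\ \sum_i\pi_{ij}\le a_j\,\forall j}b_{\mathbf a,\pi}\hat H(\pi_{ij})\quad\text{for all } i<j.$$ The switch is *stable* if $\mathbf Q(n)$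 converges in distribution to a limit $\mathbf Q$ that does not depend on the initial condition, and $\mathbb E[\mathbf Q]<\infty$. Initial conditions are the laws of $\mathbf Q(0)$ under which $Q_{ij}(0)=0$ for every pair that never issues a request ($A_{ij}\equiv 0$). The chain $\mathbf Q(n)$ is *essentially irreducible* (irreducible and aperiodic up to transient states) if some state is reached with positive probability from every initial state in every sufficiently large number of steps. The *capacity region* of a policy is the set of rate vectors $\lambda$ such that arrivals with rate $\lambda$, finite second moments and an essentially irreducible chain exist, and the switch is stable under all of them. **Theorem.** Under MW-SP, for all arrivals with $\mathbb E[A_{ij}^2(n)]<\infty$ for all $i,j$ whose queue-length chain is essentially irreducible, the switch is stable if and only if $\lambda\in\Lambda^{SP}$. Moreover the capacity region of MW-SP is equal to $\Lambda^{SP}$. -/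

import Mathlib

open MeasureTheory Filter Topology
open scoped ENNReal

noncomputable section

namespace QuantumSwitch

/-- Unordered pairs of distinct end users, represented by their ordered representatives `i < j`. -/
abbrev UserPair (K : ℕ) : Type := {e : Fin K × Fin K // e.1 < e.2}

/-- Vectors of natural numbers indexed by user pairs: queue lengths, allocations `π`, and the
numbers of swaps, successful swaps, deliveries and arrivals. -/
abbrev PairVec (K : ℕ) : Type := UserPair K → ℕ

/-- The joint law of independent `ℕ`-valued random variables with marginal laws `μ i`. -/
def prodPMF {ι : Type} [Fintype ι] (μ : ι → PMF ℕ) : PMF (ι → ℕ) :=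
  (Measure.pi fun i => (μ i).toMeasure).toPMF

theorem prodPMF_apply {ι : Type} [Fintype ι] (μ : ι → PMF ℕ) (x : ι → ℕ) :
    prodPMF μ x = ∏ i, μ i (x i) := by
  simp [prodPMF, Measure.toPMF_apply, Measure.pi_singleton,
    PMF.toMeasure_apply_singleton]

/-- The binomial law with `n` trials and success probability `p`. -/
def binomialPMF (n : ℕ) (p : unitInterval) : PMF ℕ := (ProbabilityTheory.binomial n p).toPMF

/-- A quantum switch serving `K` end users in the swap-and-purify architecture. -/
structure Switch (K : ℕ) where
  /-- number of link-level generation attempts per link and slot -/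
  alphaMax : ℕ
  /-- success probability of one link-level generation attempt -/
  p : Fin K → unitInterval
  p_pos : ∀ i, 0 < p i
  p_lt_one : ∀ i, p i < 1
  /-- success probability of an entanglement swap between the two users of a pair -/
  q : UserPair K → unitInterval
  /-- `yield x` is the conditional yield distribution `P_{Y|X}(· | x)` of the purification
  protocol: the law of the number of output pairs obtained from `x` input pairs -/
  yield : ℕ → PMF ℕ
  yield_le : ∀ x, ∀ y ∈ (yield x).support, y ≤ x

/-- A stationary scheduling policy: it maps the queue lengths and the available link-level
entanglements to the allocation `W`. -/
abbrev Policy (K : ℕ) : Type := PairVec K → (Fin K → ℕ) → PairVec K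

/-- The number of link-level entanglements of user `j` which the allocation `π` consumes. -/
def usage {K : ℕ} (π : PairVec K) (j : Fin K) : ℕ :=
  ∑ e : UserPair K, if e.1.1 = j ∨ e.1.2 = j then π e else 0

/-- The finite set of allocations `π` with `∑ i, π_{ij} ≤ a j` for every user `j`. -/
def feasible {K : ℕ} (a : Fin K → ℕ) : Finset (PairVec K) :=
  (Fintype.piFinset fun e : UserPair K => Finset.range (a e.1.1 + 1)).filter
    fun π => ∀ j, usage π j ≤ a j

theorem mem_feasible {K : ℕ} (a : Fin K → ℕ) (π : PairVec K) :
    π ∈ feasible a ↔ ∀ j, usage π j ≤ a j := by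
  refine ⟨fun h => (Finset.mem_filter.1 h).2, fun h => Finset.mem_filter.2 ⟨?_, h⟩⟩
  refine Fintype.mem_piFinset.2 fun e => Finset.mem_range.2 (Nat.lt_succ_of_le ?_)
  refine le_trans ?_ (h e.1.1)
  have := Finset.single_le_sum
    (f := fun e' : UserPair K => if e'.1.1 = e.1.1 ∨ e'.1.2 = e.1.1 then π e' else 0)
    (fun _ _ => Nat.zero_le _) (Finset.mem_univ e)
  simpa [usage] using this

/-- Every arrival sequence `A_{ij}(n)`, `n ≥ 0`, is i.i.d.; `arr e` is the law of `A_e(n)`.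
This says that all these laws have a finite second moment. -/
def FiniteSecondMoments {K : ℕ} (arr : UserPair K → PMF ℕ) : Prop :=
  ∀ e, ∑' k : ℕ, arr e k * (k : ℝ≥0∞) ^ 2 < ⊤

/-- The vector of request rates `λ_e = E[A_e(n)]`. -/
def rate {K : ℕ} (arr : UserPair K → PMF ℕ) (e : UserPair K) : ℝ :=
  ∑' k : ℕ, (arr e k).toReal * (k : ℝ)

/-- Queue vectors in which a pair that never issues a request has no pending request. -/
def Admissible {K : ℕ} (arr : UserPair K → PMF ℕ) (x : PairVec K) : Prop :=
  ∀ e, arr e = PMF.pure 0 → x e = 0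

/-- A law on queue vectors as a point of the space of probability measures, which carries the
topology of convergence in distribution. -/
def toProb {K : ℕ} (μ : PMF (PairVec K)) : ProbabilityMeasure (PairVec K) :=
  ⟨μ.toMeasure, inferInstance⟩

namespace Switch

variable {K : ℕ} (S : Switch K)

/-- The law of the vector `T(n)` of link-level entanglements generated in a slot. -/
def linkLaw : PMF (Fin K → ℕ) := prodPMF fun i => binomialPMF S.alphaMax (S.p i)

/-- The set `{0, …, alphaMax}^K` of possible values of `T(n)`. -/
def linkStates : Finset (Fin K → ℕ) := Fintype.piFinset fun _ => Finset.range (S.alphaMax + 1)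

/-- The conditional expected yield `E[Y | X = x]`. -/
def meanYield (x : ℕ) : ℝ := ∑ y ∈ Finset.range (x + 1), (y : ℝ) * (S.yield x y).toReal

/-- `Ĥ(k)` for the pair `e`: the expected number of purified pairs delivered when `k` swaps are
attempted. -/
def Hhat (e : UserPair K) (k : ℕ) : ℝ :=
  ∑ l ∈ Finset.range (k + 1),
    S.meanYield l * (k.choose l : ℝ) * (S.q e : ℝ) ^ l * (1 - (S.q e : ℝ)) ^ (k - l)

/-- The region `Λ^SP`. -/
def LambdaSP : Set (UserPair K → ℝ) :=
  {lam | (∀ e, 0 ≤ lam e) ∧ ∃ b : (Fin K → ℕ) → PairVec K → ℝ,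
    (∀ a ∈ S.linkStates, ∀ π ∈ feasible a, 0 < b a π) ∧
    (∀ a ∈ S.linkStates, ∑ π ∈ feasible a, b a π < 1) ∧
    ∀ e, lam e ≤ ∑ a ∈ S.linkStates.filter (fun a => a ≠ 0),
      (S.linkLaw a).toReal * ∑ π ∈ feasible a, b a π * S.Hhat e (π e)}

/-- `W` is a max-weight policy: it always picks a feasible allocation that maximizes
`∑ e, Ĥ(π_e) Q_e`, with an arbitrary rule for breaking ties. -/
def IsMaxWeight (W : Policy K) : Prop :=
  ∀ (Q : PairVec K), ∀ a ∈ S.linkStates, W Q a ∈ feasible a ∧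
    ∀ π ∈ feasible a, ∑ e, S.Hhat e (π e) * (Q e : ℝ) ≤ ∑ e, S.Hhat e (W Q a e) * (Q e : ℝ)

/-- The law of `Q(n+1)` given `Q(n) = Q`. The switch sees `T(n) = a`, attempts
`min (W_e) (Q_e)` swaps for each pair `e`, of which `B_e` succeed; purifying the resulting `B_e`
pairs delivers `D_e` pairs; then `Q_e(n+1) = Q_e - D_e + A_e`. Almost surely
`D_e ≤ B_e ≤ Q_e`, so the subtraction is never truncated. -/
def step (W : Policy K) (arr : UserPair K → PMF ℕ) (Q : PairVec K) : PMF (PairVec K) :=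
  S.linkLaw.bind fun a =>
  (prodPMF fun e => binomialPMF (min (W Q a e) (Q e)) (S.q e)).bind fun B =>
  (prodPMF fun e => S.yield (B e)).bind fun D =>
  (prodPMF arr).map fun A => fun e => Q e - D e + A e

/-- The law of `Q(n)` when `Q(0)` has law `ν`. -/
def queueLaw (W : Policy K) (arr : UserPair K → PMF ℕ) (ν : PMF (PairVec K)) : ℕ → PMF (PairVec K)
  | 0 => ν
  | n + 1 => (queueLaw W arr ν n).bind (S.step W arr)

/-- Stability: `Q(n)` converges in distribution to a limit that does not depend on the initial
condition and has a finite mean. -/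
def Stable (W : Policy K) (arr : UserPair K → PMF ℕ) : Prop :=
  ∃ lim : PMF (PairVec K),
    (∀ ν : PMF (PairVec K), (∀ x ∈ ν.support, Admissible arr x) →
      Tendsto (fun n => toProb (S.queueLaw W arr ν n)) atTop (𝓝 (toProb lim))) ∧
    ∀ e, ∑' x : PairVec K, lim x * (x e : ℝ≥0∞) < ⊤

/-- The queue-length chain is irreducible and aperiodic up to transient states: some state is
reached from every initial state, in every sufficiently large number of steps, with positive
probability. -/
def EssentiallyIrreducible (W : Policy K) (arr : UserPair K → PMF ℕ) : Prop :=
  ∃ z : PairVec K, ∀ x : PairVec K, Admissible arr x →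
    ∀ᶠ n in atTop, S.queueLaw W arr (PMF.pure x) n z ≠ 0

/-- The capacity region of a policy, for arrivals with finite second moments: the rates for which
the chain of queue lengths is essentially irreducible for some such arrivals, and for which the
switch is stable under all such arrivals with essentially irreducible queue lengths. -/
def capacityRegion (W : Policy K) : Set (UserPair K → ℝ) :=
  {lam |
    (∃ arr : UserPair K → PMF ℕ, FiniteSecondMoments arr ∧ rate arr = lam ∧
      S.EssentiallyIrreducible W arr) ∧
    ∀ arr : UserPair K → PMF ℕ, FiniteSecondMoments arr → rate arr = lam →
      S.EssentiallyIrreducible W arr → S.Stable W arr}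

end Switch

end QuantumSwitch

end

/-! The queue lengths form a Markov chain on a countable space, and both directions are drift
arguments.

Sufficiency. Since `∑ π, b a π < 1` for each of the finitely many link states, there is a uniform
slack `θ`. Max-weight beats every time-sharing mixture in the queue-weighted sum, so its weighted
service exceeds `1 + θ` times the weighted arrival rate, up to a constant
(`exists_sum_mul_rate_le`). Hence the sum of squared queues has drift at most `c - η ∑ Q` on
admissible states (`exists_drift`). This drift makes the Cesàro averages of the laws tight, and a
limit point is stationary with finite mean (`exists_stationary`). It also makes two independent
copies of the chain return to a finite set of pairs, from which both sit at the common state `z` at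
a common time with probability bounded below; so the initial condition is forgotten
(`limGap_eq_zero`).

Necessity. A rate vector outside `Λ^SP` is separated from the achievable service rates by some `v ≥
0` (`exists_separating`). In no state does the `v`-weighted mean service exceed the `v`-weighted
arrival rate, so `∑ v_e Q_e` never decreases in mean. A stable limit law is stationary with finite
mean, which forces this function to be constant along transitions (`eq_of_stationary_of_le_expect`).
But with positive probability no entanglement is generated while a request arrives at a pair with
`v_e > 0`, a contradiction.

For the capacity region it remains to realize each rate in `Λ^SP` by some essentially irreducible
chain. Poisson arrivals do this: the drift leads down to a finite set, and from there one slot of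
arrivals without service reaches its coordinatewise supremum. -/

noncomputable section

namespace QuantumSwitch

/-! ### Expectations under discrete laws -/

variable {α β : Type*}

/-- The expectation of a nonnegative function under a discrete law. -/
def expect (μ : PMF α) (f : α → ℝ≥0∞) : ℝ≥0∞ := ∑' x, μ x * f x

theorem expect_mono_of_support {μ : PMF α} {f g : α → ℝ≥0∞} (h : ∀ x ∈ μ.support, f x ≤ g x) :
    expect μ f ≤ expect μ g := by
  refine ENNReal.tsum_le_tsum fun x => ?_
  by_cases hx : μ x = 0
  · simp [hx]
  · gcongr
    exact h x hx

theorem expect_mono {μ : PMF α} {f g : α → ℝ≥0∞} (h : ∀ x, f x ≤ g x) :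
    expect μ f ≤ expect μ g :=
  expect_mono_of_support fun x _ => h x

theorem expect_congr_of_support {μ : PMF α} {f g : α → ℝ≥0∞} (h : ∀ x ∈ μ.support, f x = g x) :
    expect μ f = expect μ g :=
  le_antisymm (expect_mono_of_support fun x hx => (h x hx).le)
    (expect_mono_of_support fun x hx => (h x hx).ge)

theorem expect_bind (μ : PMF α) (κ : α → PMF β) (f : β → ℝ≥0∞) :
    expect (μ.bind κ) f = expect μ fun x => expect (κ x) f := by
  simp only [expect, PMF.bind_apply, ← ENNReal.tsum_mul_right, ← ENNReal.tsum_mul_left]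
  rw [ENNReal.tsum_comm]
  simp only [mul_assoc]

@[simp] theorem expect_pure (x : α) (f : α → ℝ≥0∞) : expect (PMF.pure x) f = f x := by
  classical
  rw [expect, tsum_eq_single x]
  · simp
  · intro y hy
    simp [PMF.pure_apply, hy]

theorem expect_map (μ : PMF α) (g : α → β) (f : β → ℝ≥0∞) :
    expect (μ.map g) f = expect μ fun x => f (g x) := by
  rw [PMF.map, expect_bind]
  simp

@[simp] theorem expect_const (μ : PMF α) (c : ℝ≥0∞) : expect μ (fun _ => c) = c := by
  simp [expect, ENNReal.tsum_mul_right, μ.tsum_coe]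

theorem expect_add (μ : PMF α) (f g : α → ℝ≥0∞) :
    expect μ (fun x => f x + g x) = expect μ f + expect μ g := by
  simp [expect, mul_add, ENNReal.tsum_add]

theorem expect_const_mul (μ : PMF α) (c : ℝ≥0∞) (f : α → ℝ≥0∞) :
    expect μ (fun x => c * f x) = c * expect μ f := by
  simp only [expect, ← ENNReal.tsum_mul_left]
  exact tsum_congr fun x => by ring

theorem expect_mul_const (μ : PMF α) (c : ℝ≥0∞) (f : α → ℝ≥0∞) :
    expect μ (fun x => f x * c) = expect μ f * c := by
  simp only [mul_comm _ c, expect_const_mul]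

theorem expect_finset_sum {ι : Type*} (μ : PMF α) (s : Finset ι) (f : ι → α → ℝ≥0∞) :
    expect μ (fun x => ∑ i ∈ s, f i x) = ∑ i ∈ s, expect μ (f i) := by
  classical
  induction s using Finset.induction_on with
  | empty => simp
  | insert i s hi ih => simp [Finset.sum_insert hi, expect_add, ih]

theorem expect_indicator_singleton [DecidableEq α] (μ : PMF α) (x : α) :
    expect μ (fun y => if y = x then 1 else 0) = μ x := by
  rw [expect, tsum_eq_single x]
  · simp
  · intro y hy
    simp [hy]

theorem mul_le_expect (μ : PMF α) (f : α → ℝ≥0∞) (x : α) : μ x * f x ≤ expect μ f :=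
  ENNReal.le_tsum (f := fun x => μ x * f x) x

theorem ne_top_of_expect_ne_top {μ : PMF α} {f : α → ℝ≥0∞} (h : expect μ f ≠ ∞) {x : α}
    (hx : x ∈ μ.support) : f x ≠ ∞ := fun hf => by
  have := mul_le_expect μ f x
  rw [hf, ENNReal.mul_top hx] at this
  exact h (top_le_iff.1 this)

/-- Functions that are ordered on the support and have the same finite expectation agree there. -/
theorem eq_on_support_of_expect_le {μ : PMF α} {f g : α → ℝ≥0∞}
    (hfg : ∀ x ∈ μ.support, f x ≤ g x) (hle : expect μ g ≤ expect μ f) (hf : expect μ f ≠ ∞) :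
    ∀ x ∈ μ.support, f x = g x := by
  -- Truncated subtraction is exact on the support, so `g - f` has expectation zero once the finite
  -- expectation of `f` is cancelled.
  have hsub : expect μ (fun x => g x - f x) = 0 := by
    have h1 : expect μ g = expect μ (fun x => g x - f x) + expect μ f := by
      rw [← expect_add]
      exact expect_congr_of_support fun x hx => (tsub_add_cancel_of_le (hfg x hx)).symm
    rw [h1] at hle
    have h2 : expect μ (fun x => g x - f x) + expect μ f ≤ 0 + expect μ f := by simpa using hle
    exact le_antisymm ((ENNReal.add_le_add_iff_right hf).1 h2) zero_le
  intro x hx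
  have h0 := mul_le_expect μ (fun x => g x - f x) x
  rw [hsub] at h0
  have h1 : g x - f x = 0 := by
    rcases mul_eq_zero.1 (le_antisymm h0 zero_le) with h | h
    · exact absurd h hx
    · exact h
  exact le_antisymm (hfg x hx) (tsub_eq_zero_iff_le.1 h1)

theorem expect_eq_lintegral [Countable α] [MeasurableSpace α] [MeasurableSingletonClass α]
    (μ : PMF α) (f : α → ℝ≥0∞) : expect μ f = ∫⁻ x, f x ∂μ.toMeasure := by
  rw [lintegral_countable']
  exact tsum_congr fun x => by
    rw [PMF.toMeasure_apply_singleton _ _ (measurableSet_singleton x), mul_comm]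

theorem prodPMF_map_eval {ι : Type} [Fintype ι] (μ : ι → PMF ℕ) (i : ι) :
    (prodPMF μ).map (fun x => x i) = μ i := by
  apply PMF.toMeasure_injective
  rw [← PMF.toMeasure_map (fun x : ι → ℕ => x i) _ (measurable_pi_apply i)]
  rw [prodPMF, Measure.toPMF_toMeasure]
  exact (measurePreserving_eval (fun i => (μ i).toMeasure) i).map_eq

theorem expect_prodPMF_eval {ι : Type} [Fintype ι] (μ : ι → PMF ℕ) (i : ι) (g : ℕ → ℝ≥0∞) :
    expect (prodPMF μ) (fun x => g (x i)) = expect (μ i) g := by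
  rw [← expect_map (prodPMF μ) (fun x => x i) g, prodPMF_map_eval]

theorem mem_support_prodPMF {ι : Type} [Fintype ι] {μ : ι → PMF ℕ} {x : ι → ℕ} :
    x ∈ (prodPMF μ).support ↔ ∀ i, x i ∈ (μ i).support := by
  simp [PMF.mem_support_iff, prodPMF_apply, Finset.prod_eq_zero_iff]

/-- A function with expectation below `c` is below `c` at some point of the support. -/
theorem exists_support_lt {μ : PMF α} {f : α → ℝ≥0∞} {c : ℝ≥0∞} (h : expect μ f < c) :
    ∃ x ∈ μ.support, f x < c := by
  by_contra! hc
  have := expect_mono_of_support (f := fun _ => c) hc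
  rw [expect_const] at this
  exact absurd h (not_lt.2 this)

/-! ### Markov chains on discrete spaces -/

variable {α : Type*}

/-- The law at time `n` of the Markov chain with kernel `κ` and initial law `ν`. -/
def chainLaw (κ : α → PMF α) (ν : PMF α) : ℕ → PMF α
  | 0 => ν
  | n + 1 => (chainLaw κ ν n).bind κ

theorem chainLaw_add (κ : α → PMF α) (ν : PMF α) (m n : ℕ) :
    chainLaw κ ν (m + n) = chainLaw κ (chainLaw κ ν m) n := by
  induction n with
  | zero => rfl
  | succ n ih => rw [← add_assoc, chainLaw, ih, chainLaw]

theorem chainLaw_bind (κ : α → PMF α) (ν : PMF α) (n : ℕ) :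
    chainLaw κ ν n = ν.bind fun x => chainLaw κ (PMF.pure x) n := by
  induction n with
  | zero => simp [chainLaw]
  | succ n ih => simp only [chainLaw, ih, PMF.bind_bind]

theorem expect_chainLaw (κ : α → PMF α) (ν : PMF α) (n : ℕ) (f : α → ℝ≥0∞) :
    expect (chainLaw κ ν n) f = expect ν fun x => expect (chainLaw κ (PMF.pure x) n) f := by
  rw [chainLaw_bind, expect_bind]

theorem expect_chainLaw_succ (κ : α → PMF α) (ν : PMF α) (n : ℕ) (f : α → ℝ≥0∞) :
    expect (chainLaw κ ν (n + 1)) f = expect (chainLaw κ ν n) fun x => expect (κ x) f := by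
  rw [chainLaw, expect_bind]

/-- A set of states which the chain does not leave. -/
def IsClosedSet (κ : α → PMF α) (A : Set α) : Prop := ∀ x ∈ A, (κ x).support ⊆ A

theorem IsClosedSet.chainLaw {κ : α → PMF α} {A : Set α} (hA : IsClosedSet κ A) {ν : PMF α}
    (hν : ν.support ⊆ A) (n : ℕ) : (chainLaw κ ν n).support ⊆ A := by
  induction n with
  | zero => exact hν
  | succ n ih =>
    intro y hy
    obtain ⟨x, hx, hxy⟩ := (PMF.mem_support_bind_iff _ _ _).1 hy
    exact hA x (ih hx) hxy

theorem IsClosedSet.chainLaw_pure {κ : α → PMF α} {A : Set α} (hA : IsClosedSet κ A) {x : α}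
    (hx : x ∈ A) (n : ℕ) : (QuantumSwitch.chainLaw κ (PMF.pure x) n).support ⊆ A :=
  hA.chainLaw (by simpa using hx) n

/-! ### Loss of memory, by independent coupling -/

section Coupling

/-- Reverse Fatou lemma, with the constant 1 as dominating function. -/
theorem limsup_expect_le [Countable α] (μ : PMF α) {f : ℕ → α → ℝ≥0∞} (hf : ∀ n x, f n x ≤ 1) :
    limsup (fun n => expect μ (f n)) atTop ≤ expect μ fun x => limsup (fun n => f n x) atTop := by
  let _ : MeasurableSpace α := ⊤
  have : MeasurableSingletonClass α := ⟨fun _ => trivial⟩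
  simp only [expect_eq_lintegral]
  refine limsup_lintegral_le (fun _ => 1) (fun n => fun _ _ => trivial)
    (fun n => Eventually.of_forall (hf n)) ?_
  simp

/-- The positive part of the difference of the expectations of `f` at time `n` for the chains
started at `x` and at `y`. -/
def gap (κ : α → PMF α) (f : α → ℝ≥0∞) (n : ℕ) (x y : α) : ℝ≥0∞ :=
  expect (chainLaw κ (PMF.pure x) n) f - expect (chainLaw κ (PMF.pure y) n) f

theorem gap_le_one (κ : α → PMF α) {f : α → ℝ≥0∞} (hf : ∀ x, f x ≤ 1) (n : ℕ) (x y : α) :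
    gap κ f n x y ≤ 1 := by
  refine tsub_le_self.trans ?_
  simpa using expect_mono (μ := chainLaw κ (PMF.pure x) n) hf

/-- A test function is compared at two initial laws by coupling these laws independently. -/
theorem expect_chainLaw_le (κ : α → PMF α) (f : α → ℝ≥0∞) (n : ℕ) (μ ν : PMF α) :
    expect (chainLaw κ μ n) f ≤
      expect (chainLaw κ ν n) f + expect μ fun x => expect ν fun y => gap κ f n x y := by
  rw [expect_chainLaw κ μ, expect_chainLaw κ ν]
  calc expect μ (fun x => expect (chainLaw κ (PMF.pure x) n) f)
      ≤ expect μ (fun x => expect ν fun y =>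
          expect (chainLaw κ (PMF.pure y) n) f + gap κ f n x y) := by
        refine expect_mono fun x => ?_
        rw [← expect_const ν (expect (chainLaw κ (PMF.pure x) n) f)]
        refine expect_mono fun y => ?_
        rw [gap]
        exact le_add_tsub
    _ = _ := by simp only [expect_add, expect_const]

/-- Markov property at time `m`: the two laws reached by then serve as initial laws and are coupled
independently. -/
theorem gap_add_le (κ : α → PMF α) {f : α → ℝ≥0∞} (m n : ℕ) (x y : α) :
    gap κ f (m + n) x y ≤ expect (chainLaw κ (PMF.pure x) m) fun x' =>
      expect (chainLaw κ (PMF.pure y) m) fun y' => gap κ f n x' y' := by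
  rw [gap, chainLaw_add, chainLaw_add, tsub_le_iff_left]
  exact expect_chainLaw_le κ f n _ _

/-- The asymptotic gap. -/
def limGap (κ : α → PMF α) (f : α → ℝ≥0∞) (x y : α) : ℝ≥0∞ :=
  limsup (fun n => gap κ f n x y) atTop

theorem limGap_le_one (κ : α → PMF α) {f : α → ℝ≥0∞} (hf : ∀ x, f x ≤ 1) (x y : α) :
    limGap κ f x y ≤ 1 :=
  limsup_le_of_le (h := Eventually.of_forall fun n => gap_le_one κ hf n x y)

theorem limsup_expect_gap_le [Countable α] (κ : α → PMF α) {f : α → ℝ≥0∞} (hf : ∀ x, f x ≤ 1)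
    (μ ν : PMF α) :
    limsup (fun n => expect μ fun x => expect ν fun y => gap κ f n x y) atTop ≤
      expect μ fun x => expect ν fun y => limGap κ f x y := by
  refine (limsup_expect_le μ fun n x => ?_).trans (expect_mono fun x => ?_)
  · simpa using expect_mono (μ := ν) fun y => gap_le_one κ hf n x y
  · exact limsup_expect_le ν fun n y => gap_le_one κ hf n x y

/-- Subharmonicity of the asymptotic gap for two independent copies; the case `m = 1` feeds the
maximum principle and a larger `m` gives the contraction. -/
theorem limGap_le [Countable α] (κ : α → PMF α) {f : α → ℝ≥0∞} (hf : ∀ x, f x ≤ 1) (m : ℕ)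
    (x y : α) :
    limGap κ f x y ≤ expect (chainLaw κ (PMF.pure x) m) fun x' =>
      expect (chainLaw κ (PMF.pure y) m) fun y' => limGap κ f x' y' := by
  refine le_trans ?_ (limsup_expect_gap_le κ hf _ _)
  rw [limGap, ← limsup_nat_add _ m]
  refine limsup_le_limsup (Eventually.of_forall fun n => ?_)
  simp only [add_comm n m]
  exact gap_add_le κ m n x y

open Classical in
/-- The probability that two independent copies of the chain have avoided `C` before time `n`. -/
def avoid (κ : α → PMF α) (C : Set (α × α)) : ℕ → α → α → ℝ≥0∞
  | 0, _, _ => 1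
  | n + 1, x, y =>
    if (x, y) ∈ C then 0 else expect (κ x) fun x' => expect (κ y) fun y' => avoid κ C n x' y'

variable {κ : α → PMF α} {A : Set α} {C : Set (α × α)} {V : α → ℝ≥0∞}

/-- The sum is a truncated expected hitting time of `C`. Outside `C` each step costs one unit of `V
x + V y`; the extra 1 is the term `i = 0`. -/
theorem sum_avoid_le (hA : IsClosedSet κ A)
    (hV : ∀ x ∈ A, ∀ y ∈ A, (x, y) ∉ C → expect (κ x) V + expect (κ y) V + 1 ≤ V x + V y)
    (n : ℕ) : ∀ x ∈ A, ∀ y ∈ A, ∑ i ∈ Finset.range n, avoid κ C i x y ≤ 1 + (V x + V y) := by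
  induction n with
  | zero => simp
  | succ n ih =>
    intro x hx y hy
    rw [Finset.sum_range_succ', add_comm]
    refine add_le_add (by simp [avoid]) ?_
    by_cases hC : (x, y) ∈ C
    · simp [avoid, hC]
    · simp only [avoid, hC, if_false]
      calc ∑ i ∈ Finset.range n, expect (κ x) (fun x' => expect (κ y) fun y' => avoid κ C i x' y')
          = expect (κ x) (fun x' => expect (κ y) fun y' =>
              ∑ i ∈ Finset.range n, avoid κ C i x' y') := by
            simp only [expect_finset_sum]
        _ ≤ expect (κ x) (fun x' => expect (κ y) fun y' => 1 + (V x' + V y')) :=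
            expect_mono_of_support fun x' hx' => expect_mono_of_support fun y' hy' =>
              ih x' (hA x hx hx') y' (hA y hy hy')
        _ = expect (κ x) V + expect (κ y) V + 1 := by
            simp only [expect_add, expect_const]
            ring
        _ ≤ V x + V y := hV x hx y hy hC

theorem tendsto_avoid (hA : IsClosedSet κ A) (hVfin : ∀ x, V x ≠ ∞)
    (hV : ∀ x ∈ A, ∀ y ∈ A, (x, y) ∉ C → expect (κ x) V + expect (κ y) V + 1 ≤ V x + V y)
    {x y : α} (hx : x ∈ A) (hy : y ∈ A) :
    Tendsto (fun n => avoid κ C n x y) atTop (𝓝 0) := by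
  refine ENNReal.tendsto_atTop_zero_of_tsum_ne_top (ne_top_of_le_ne_top ?_
    (ENNReal.tsum_le_of_sum_range_le fun n => sum_avoid_le hA hV n x hx y hy))
  simp [hVfin]

/-- A maximum principle: a bounded function of two independent copies of the chain which is
subharmonic is bounded by its values on a recurrent set. -/
theorem le_of_subharmonic (hA : IsClosedSet κ A) (hVfin : ∀ x, V x ≠ ∞)
    (hV : ∀ x ∈ A, ∀ y ∈ A, (x, y) ∉ C → expect (κ x) V + expect (κ y) V + 1 ≤ V x + V y)
    {u : α → α → ℝ≥0∞} {s c : ℝ≥0∞} (hs : s ≠ ∞) (hus : ∀ x ∈ A, ∀ y ∈ A, u x y ≤ s)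
    (huC : ∀ x ∈ A, ∀ y ∈ A, (x, y) ∈ C → u x y ≤ c)
    (hu : ∀ x ∈ A, ∀ y ∈ A, u x y ≤ expect (κ x) fun x' => expect (κ y) fun y' => u x' y') :
    ∀ x ∈ A, ∀ y ∈ A, u x y ≤ c := by
  -- Iterating subharmonicity until the pair enters `C` leaves at most `c` from the visit and `s` on
  -- the event that `C` is still avoided.
  have key : ∀ n, ∀ x ∈ A, ∀ y ∈ A, u x y ≤ c + s * avoid κ C n x y := by
    intro n
    induction n with
    | zero =>
      intro x hx y hy
      simpa [avoid] using (hus x hx y hy).trans le_add_self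
    | succ n ih =>
      intro x hx y hy
      by_cases hC : (x, y) ∈ C
      · exact (huC x hx y hy hC).trans le_self_add
      · refine (hu x hx y hy).trans ?_
        calc expect (κ x) (fun x' => expect (κ y) fun y' => u x' y')
            ≤ expect (κ x) (fun x' => expect (κ y) fun y' => c + s * avoid κ C n x' y') :=
              expect_mono_of_support fun x' hx' => expect_mono_of_support fun y' hy' =>
                ih x' (hA x hx hx') y' (hA y hy hy')
          _ = c + s * avoid κ C (n + 1) x y := by
              simp [expect_add, expect_const_mul, avoid, hC]
  intro x hx y hy
  have h := (ENNReal.Tendsto.const_mul (a := s) (tendsto_avoid hA hVfin hV hx hy)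
    (Or.inr hs)).const_add c
  simp only [mul_zero, add_zero] at h
  exact ge_of_tendsto' h fun n => key n x hx y hy

/-- Let `s` be the supremum of the asymptotic gap over `A ×ˢ A`. From a pair in `C` both copies are
at `z` at time `N` with probability at least `δ`, and the gap vanishes there, so the gap on `C` is
at most `s - s * δ`. The maximum principle carries this bound to all pairs, whence `s ≤ s - s * δ`
and `s = 0`. -/
theorem limGap_eq_zero [Countable α] (hA : IsClosedSet κ A) (hVfin : ∀ x, V x ≠ ∞)
    (hV : ∀ x ∈ A, ∀ y ∈ A, (x, y) ∉ C → expect (κ x) V + expect (κ y) V + 1 ≤ V x + V y)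
    (hC : (C ∩ A ×ˢ A).Finite) {z : α}
    (hz : ∀ x ∈ A, ∀ᶠ n in atTop, chainLaw κ (PMF.pure x) n z ≠ 0)
    {f : α → ℝ≥0∞} (hf : ∀ x, f x ≤ 1) : ∀ x ∈ A, ∀ y ∈ A, limGap κ f x y = 0 := by
  classical
  -- Finiteness of the recurrent set gives one time `N` that works for all its pairs, and then one
  -- lower bound `δ`.
  obtain ⟨N, hN⟩ : ∃ N, ∀ p ∈ C ∩ A ×ˢ A,
      chainLaw κ (PMF.pure p.1) N z ≠ 0 ∧ chainLaw κ (PMF.pure p.2) N z ≠ 0 := by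
    have := (eventually_all_finite hC).2 fun p hp => (hz p.1 hp.2.1).and (hz p.2 hp.2.2)
    exact this.exists
  obtain ⟨δ, hδ0, hδ1, hδ⟩ : ∃ δ : ℝ≥0∞, δ ≠ 0 ∧ δ ≤ 1 ∧ ∀ p ∈ C ∩ A ×ˢ A,
      δ ≤ chainLaw κ (PMF.pure p.1) N z * chainLaw κ (PMF.pure p.2) N z := by
    refine ⟨min 1 (hC.toFinset.inf fun p =>
      chainLaw κ (PMF.pure p.1) N z * chainLaw κ (PMF.pure p.2) N z), ?_, min_le_left _ _, ?_⟩
    · refine (lt_min one_pos ?_).ne'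
      rw [Finset.lt_inf_iff (by simp)]
      intro p hp
      have := hN p (hC.mem_toFinset.1 hp)
      exact pos_iff_ne_zero.2 (mul_ne_zero this.1 this.2)
    · intro p hp
      exact (min_le_right _ _).trans (Finset.inf_le (hC.mem_toFinset.2 hp))
  set s : ℝ≥0∞ := ⨆ p ∈ A ×ˢ A, limGap κ f p.1 p.2 with hs
  have hs1 : s ≤ 1 := iSup₂_le fun p _ => limGap_le_one κ hf p.1 p.2
  have hs_fin : s ≠ ∞ := ne_top_of_le_ne_top ENNReal.one_ne_top hs1
  have hus : ∀ x ∈ A, ∀ y ∈ A, limGap κ f x y ≤ s := fun x hx y hy =>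
    le_iSup₂_of_le (x, y) ⟨hx, hy⟩ le_rfl
  have hlt : ∀ x ∈ A, ∀ y ∈ A, (x, y) ∈ C → limGap κ f x y ≤ s - s * δ := by
    intro x hx y hy hxy
    refine ENNReal.le_sub_of_add_le_right (ENNReal.mul_ne_top hs_fin
      (ne_top_of_le_ne_top ENNReal.one_ne_top hδ1)) ?_
    calc limGap κ f x y + s * δ
        ≤ expect (chainLaw κ (PMF.pure x) N) (fun x' =>
            expect (chainLaw κ (PMF.pure y) N) fun y' => limGap κ f x' y') +
          s * (chainLaw κ (PMF.pure x) N z * chainLaw κ (PMF.pure y) N z) := by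
          gcongr
          · exact limGap_le κ hf N x y
          · exact hδ (x, y) ⟨hxy, hx, hy⟩
      _ = expect (chainLaw κ (PMF.pure x) N) (fun x' =>
            expect (chainLaw κ (PMF.pure y) N) fun y' => limGap κ f x' y' +
              s * ((if x' = z then 1 else 0) * (if y' = z then 1 else 0))) := by
          simp only [expect_add, expect_const_mul, expect_indicator_singleton, expect_mul_const]
      _ ≤ expect (chainLaw κ (PMF.pure x) N) (fun x' =>
            expect (chainLaw κ (PMF.pure y) N) fun y' => s) := by
          refine expect_mono_of_support fun x' hx' => expect_mono_of_support fun y' hy' => ?_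
          by_cases h1 : x' = z
          · by_cases h2 : y' = z
            · subst h1 h2
              simp [limGap, gap]
            · simpa [h1, h2] using hus z (h1 ▸ hA.chainLaw_pure hx N hx') y'
                (hA.chainLaw_pure hy N hy')
          · simpa [h1] using hus x' (hA.chainLaw_pure hx N hx') y' (hA.chainLaw_pure hy N hy')
      _ = s := by simp
  have hle := le_of_subharmonic hA hVfin hV hs_fin hus hlt fun x _ y _ => by
    simpa [chainLaw] using limGap_le κ hf 1 x y
  have hss : s ≤ s - s * δ := iSup₂_le fun p hp => hle p.1 hp.1 p.2 hp.2
  have hsδ : s * δ ≤ s := mul_le_of_le_one_right zero_le hδ1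
  have h1 : s + s * δ ≤ s + 0 := by
    rw [add_zero]
    exact (add_le_add_left hss _).trans (tsub_add_cancel_of_le hsδ).le
  have h2 : s * δ = 0 := le_antisymm ((ENNReal.add_le_add_iff_left hs_fin).1 h1) zero_le
  have h3 : s = 0 := (mul_eq_zero.1 h2).resolve_right hδ0
  intro x hx y hy
  exact le_antisymm (h3 ▸ hus x hx y hy) zero_le

end Coupling

/-! ### Stationary laws and the ergodic theorem -/

section Stationary

variable {α : Type*} {κ : α → PMF α} {A : Set α} {V w : α → ℝ≥0∞} {c : ℝ≥0∞}

/-- The average of the laws of the chain at the times `0, …, n`, as a weight. -/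
def cesaro (κ : α → PMF α) (x : α) (n : ℕ) (y : α) : ℝ≥0∞ :=
  (n + 1 : ℝ≥0∞)⁻¹ * ∑ k ∈ Finset.range (n + 1), chainLaw κ (PMF.pure x) k y

theorem tsum_cesaro_mul (κ : α → PMF α) (x : α) (n : ℕ) (f : α → ℝ≥0∞) :
    ∑' y, cesaro κ x n y * f y =
      (n + 1 : ℝ≥0∞)⁻¹ *
        ∑ k ∈ Finset.range (n + 1), expect (chainLaw κ (PMF.pure x) k) f := by
  simp only [cesaro, expect, mul_assoc, ENNReal.tsum_mul_left, Finset.sum_mul]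
  rw [Summable.tsum_finsetSum fun _ _ => ENNReal.summable]

theorem tsum_cesaro (κ : α → PMF α) (x : α) (n : ℕ) : ∑' y, cesaro κ x n y = 1 := by
  have h := tsum_cesaro_mul κ x n fun _ => 1
  simp only [mul_one, expect_const, Finset.sum_const, Finset.card_range, nsmul_eq_mul] at h
  rw [h]
  push_cast
  exact ENNReal.inv_mul_cancel (by simp) (by simp)

/-- The drift inequality, summed along the trajectory without subtraction. -/
theorem expect_chainLaw_add_sum_le (hA : IsClosedSet κ A)
    (hdrift : ∀ x ∈ A, expect (κ x) V + w x ≤ V x + c) {x : α} (hx : x ∈ A) (n : ℕ) :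
    expect (chainLaw κ (PMF.pure x) n) V +
      ∑ k ∈ Finset.range n, expect (chainLaw κ (PMF.pure x) k) w ≤ V x + n * c := by
  induction n with
  | zero => simp [chainLaw]
  | succ n ih =>
    rw [Finset.sum_range_succ, expect_chainLaw_succ]
    calc expect (chainLaw κ (PMF.pure x) n) (fun x => expect (κ x) V) +
          (∑ k ∈ Finset.range n, expect (chainLaw κ (PMF.pure x) k) w +
            expect (chainLaw κ (PMF.pure x) n) w)
        = expect (chainLaw κ (PMF.pure x) n) (fun x => expect (κ x) V + w x) +
          ∑ k ∈ Finset.range n, expect (chainLaw κ (PMF.pure x) k) w := by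
          rw [expect_add]
          ring
      _ ≤ expect (chainLaw κ (PMF.pure x) n) (fun x => V x + c) +
          ∑ k ∈ Finset.range n, expect (chainLaw κ (PMF.pure x) k) w := by
          gcongr
          exact expect_mono_of_support fun y hy => hdrift y (hA.chainLaw_pure hx n hy)
      _ = expect (chainLaw κ (PMF.pure x) n) V +
          ∑ k ∈ Finset.range n, expect (chainLaw κ (PMF.pure x) k) w + c := by
          rw [expect_add, expect_const]
          ring
      _ ≤ V x + n * c + c := by gcongr
      _ = V x + (n + 1 : ℕ) * c := by
          push_cast
          ring

theorem tsum_cesaro_mul_le (hA : IsClosedSet κ A)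
    (hdrift : ∀ x ∈ A, expect (κ x) V + w x ≤ V x + c) {x : α} (hx : x ∈ A) (n : ℕ) :
    ∑' y, cesaro κ x n y * w y ≤ V x + c := by
  rw [tsum_cesaro_mul]
  have h := le_add_self.trans (expect_chainLaw_add_sum_le hA hdrift hx (n + 1))
  have h1 : V x + (n + 1 : ℕ) * c ≤ (n + 1 : ℝ≥0∞) * (V x + c) := by
    push_cast
    rw [mul_add]
    gcongr
    exact le_mul_of_one_le_left zero_le le_add_self
  calc _ ≤ (n + 1 : ℝ≥0∞)⁻¹ * ((n + 1 : ℝ≥0∞) * (V x + c)) := by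
        gcongr
        exact h.trans h1
    _ = V x + c := by
        rw [← mul_assoc, ENNReal.inv_mul_cancel (by simp) (by simp), one_mul]

/-- A version of Fatou's lemma for limits of weights along an ultrafilter. -/
theorem tsum_mul_le_of_tendsto {U : Ultrafilter ℕ} {a : ℕ → α → ℝ≥0∞} {l : α → ℝ≥0∞}
    (ha : ∀ y, Tendsto (fun n => a n y) U (𝓝 (l y))) {f : α → ℝ≥0∞} (hf : ∀ y, f y ≠ ∞)
    {b : ℕ → ℝ≥0∞} {B : ℝ≥0∞} (hb : Tendsto b U (𝓝 B)) (hab : ∀ n, ∑' y, a n y * f y ≤ b n) :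
    ∑' y, l y * f y ≤ B := by
  rw [ENNReal.tsum_eq_iSup_sum]
  refine iSup_le fun s => ?_
  have h : Tendsto (fun n => ∑ y ∈ s, a n y * f y) U (𝓝 (∑ y ∈ s, l y * f y)) :=
    tendsto_finsetSum _ fun y _ => ENNReal.Tendsto.mul_const (ha y) (Or.inr (hf y))
  exact le_of_tendsto_of_tendsto' h hb fun n => (ENNReal.sum_le_tsum s).trans (hab n)

/-- Both masses are 1, so the nonnegative differences sum to zero. -/
theorem pmf_eq_of_le {p q : PMF α} (h : ∀ x, p x ≤ q x) : p = q := by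
  have hq : ∑' x, (q x - p x) = 0 := by
    have h1 : ∑' x, (q x - p x) + 1 = 0 + 1 := by
      rw [zero_add, ← p.tsum_coe, ← ENNReal.tsum_add, p.tsum_coe, ← q.tsum_coe]
      exact tsum_congr fun x => tsub_add_cancel_of_le (h x)
    exact (ENNReal.add_left_inj ENNReal.one_ne_top).1 h1
  refine PMF.ext fun x => le_antisymm (h x) ?_
  exact tsub_eq_zero_iff_le.1 (ENNReal.tsum_eq_zero.1 hq x)

/-- Under a drift condition the chain has a stationary law, with a moment bound. -/
theorem exists_stationary (hA : IsClosedSet κ A) {x₀ : α} (hx₀ : x₀ ∈ A)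
    (hV : V x₀ ≠ ∞) (hw : ∀ x, w x ≠ ∞) (hc : c ≠ ∞)
    (hdrift : ∀ x ∈ A, expect (κ x) V + w x ≤ V x + c)
    (hfin : ∀ n : ℕ, {x ∈ A | w x ≤ n}.Finite) :
    ∃ μ : PMF α, μ.support ⊆ A ∧ μ.bind κ = μ ∧ expect μ w ≠ ∞ := by
  classical
  -- Every ultrafilter on the compact space `ℝ≥0∞` converges, so along `U` all the Cesàro weights
  -- converge at once and no diagonal subsequence is needed.
  set U : Ultrafilter ℕ := hyperfilter ℕ with hU
  have hUat : (U : Filter ℕ) ≤ atTop := Nat.hyperfilter_le_atTop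
  set M : ℝ≥0∞ := V x₀ + c with hM
  have hMtop : M ≠ ∞ := ENNReal.add_ne_top.2 ⟨hV, hc⟩
  obtain ⟨l, hl⟩ : ∃ l : α → ℝ≥0∞, ∀ y, Tendsto (fun n => cesaro κ x₀ n y) U (𝓝 (l y)) := by
    refine ⟨fun y => (U.map fun n => cesaro κ x₀ n y).lim, fun y => ?_⟩
    exact Ultrafilter.le_nhds_lim (U.map fun n => cesaro κ x₀ n y)
  have hlA : ∀ y, y ∉ A → l y = 0 := by
    intro y hy
    have h0 : ∀ n, cesaro κ x₀ n y = 0 := fun n => by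
      rw [cesaro, Finset.sum_eq_zero, mul_zero]
      intro k _
      rw [PMF.apply_eq_zero_iff]
      exact fun hk => hy (hA.chainLaw_pure hx₀ k hk)
    have := hl y
    simp only [h0] at this
    exact tendsto_nhds_unique this tendsto_const_nhds
  have hle : ∑' y, l y ≤ 1 := by
    simpa using tsum_mul_le_of_tendsto hl (f := fun _ => 1) (by simp)
      (tendsto_const_nhds (x := (1 : ℝ≥0∞))) fun n => by simp [tsum_cesaro]
  -- Markov's inequality: outside the finite set where `w ≤ R + 1` the averages carry mass at most
  -- `M / (R + 1)`, so no mass escapes in the limit.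
  have htight : ∀ R : ℕ, 1 ≤ ∑' y, l y + M * (R + 1 : ℝ≥0∞)⁻¹ := by
    intro R
    set F := (hfin (R + 1)).toFinset with hF
    have hn : ∀ n, 1 ≤ ∑ y ∈ F, cesaro κ x₀ n y + M * (R + 1 : ℝ≥0∞)⁻¹ := by
      intro n
      have h1 : ∀ y, cesaro κ x₀ n y ≤ (if y ∈ F then cesaro κ x₀ n y else 0) +
          cesaro κ x₀ n y * w y * (R + 1 : ℝ≥0∞)⁻¹ := by
        intro y
        by_cases hyF : y ∈ F
        · simp [hyF]
        by_cases hyA : y ∈ A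
        · have hwy : (R + 1 : ℝ≥0∞) ≤ w y := by
            by_contra! hlt
            exact hyF ((hfin (R + 1)).mem_toFinset.2 ⟨hyA, by push_cast; exact hlt.le⟩)
          have h2 : 1 ≤ w y * (R + 1 : ℝ≥0∞)⁻¹ := by
            calc (1 : ℝ≥0∞) = (R + 1) * (R + 1 : ℝ≥0∞)⁻¹ :=
                  (ENNReal.mul_inv_cancel (by simp) (by simp)).symm
              _ ≤ _ := by gcongr
          rw [if_neg hyF, zero_add, mul_assoc]
          exact le_mul_of_one_le_right zero_le h2
        · have h0 : cesaro κ x₀ n y = 0 := by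
            rw [cesaro, Finset.sum_eq_zero, mul_zero]
            intro k _
            rw [PMF.apply_eq_zero_iff]
            exact fun hk => hyA (hA.chainLaw_pure hx₀ k hk)
          simp [h0]
      calc (1 : ℝ≥0∞) = ∑' y, cesaro κ x₀ n y := (tsum_cesaro κ x₀ n).symm
        _ ≤ ∑' y, ((if y ∈ F then cesaro κ x₀ n y else 0) +
            cesaro κ x₀ n y * w y * (R + 1 : ℝ≥0∞)⁻¹) := ENNReal.tsum_le_tsum h1
        _ = ∑ y ∈ F, cesaro κ x₀ n y +
            (∑' y, cesaro κ x₀ n y * w y) * (R + 1 : ℝ≥0∞)⁻¹ := by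
            rw [ENNReal.tsum_add, ENNReal.tsum_mul_right,
              tsum_eq_sum (s := F) (fun y hy => by simp [hy])]
            congr 1
            exact Finset.sum_congr rfl fun y hy => by simp [hy]
        _ ≤ _ := by
            gcongr
            exact tsum_cesaro_mul_le hA hdrift hx₀ n
    have hlim : Tendsto (fun n => ∑ y ∈ F, cesaro κ x₀ n y + M * (R + 1 : ℝ≥0∞)⁻¹) U
        (𝓝 (∑ y ∈ F, l y + M * (R + 1 : ℝ≥0∞)⁻¹)) :=
      (tendsto_finsetSum _ fun y _ => hl y).add_const _
    refine (ge_of_tendsto' hlim hn).trans ?_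
    gcongr
    exact ENNReal.sum_le_tsum F
  have hge : 1 ≤ ∑' y, l y := by
    have h0 : Tendsto (fun R : ℕ => ∑' y, l y + M * ((R + 1 : ℕ) : ℝ≥0∞)⁻¹) atTop
        (𝓝 (∑' y, l y + M * 0)) :=
      (ENNReal.Tendsto.const_mul
        (ENNReal.tendsto_inv_nat_nhds_zero.comp (tendsto_add_atTop_nat 1))
        (Or.inr hMtop)).const_add _
    rw [mul_zero, add_zero] at h0
    refine ge_of_tendsto' h0 fun R => ?_
    have := htight R
    push_cast
    exact this
  have hsum : ∑' y, l y = 1 := le_antisymm hle hge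
  let μ : PMF α := ⟨l, by rw [← hsum]; exact ENNReal.summable.hasSum⟩
  have hμ : ∀ y, μ y = l y := fun _ => rfl
  -- By `pmf_eq_of_le` it suffices that `μ.bind κ ≤ μ` pointwise, which is the direction that
  -- Fatou's lemma provides.
  refine ⟨μ, fun y hy => ?_, pmf_eq_of_le fun y => ?_, ?_⟩
  · by_contra hyA
    exact hy (hlA y hyA)
  · rw [PMF.bind_apply]
    simp only [hμ]
    have hinv : Tendsto (fun n : ℕ => ((n + 1 : ℕ) : ℝ≥0∞)⁻¹) U (𝓝 0) :=
      (ENNReal.tendsto_inv_nat_nhds_zero.comp (tendsto_add_atTop_nat 1)).mono_left hUat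
    have hb := (hl y).add hinv
    rw [add_zero] at hb
    refine tsum_mul_le_of_tendsto hl (fun x => (κ x).apply_ne_top y) hb fun n => ?_
    rw [tsum_cesaro_mul]
    have hstep : ∀ k, expect (chainLaw κ (PMF.pure x₀) k) (fun x => κ x y) =
        chainLaw κ (PMF.pure x₀) (k + 1) y := fun k => by
      rw [chainLaw, PMF.bind_apply, expect]
    simp only [hstep]
    -- Shifting time by one changes the sum by at most one boundary term, which vanishes after
    -- division by `n + 1`.
    have hshift : ∑ k ∈ Finset.range (n + 1), chainLaw κ (PMF.pure x₀) (k + 1) y ≤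
        ∑ k ∈ Finset.range (n + 1), chainLaw κ (PMF.pure x₀) k y + 1 := by
      rw [Finset.sum_range_succ]
      refine add_le_add ?_ (PMF.coe_le_one _ _)
      rw [Finset.sum_range_succ']
      exact le_self_add
    calc _ ≤ (n + 1 : ℝ≥0∞)⁻¹ *
          (∑ k ∈ Finset.range (n + 1), chainLaw κ (PMF.pure x₀) k y + 1) := by gcongr
      _ = _ := by
          rw [cesaro]
          push_cast
          ring
  · refine ne_top_of_le_ne_top hMtop ?_
    exact tsum_mul_le_of_tendsto hl hw (tendsto_const_nhds (x := M))
      fun n => tsum_cesaro_mul_le hA hdrift hx₀ n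

theorem chainLaw_stationary {μ : PMF α} (h : μ.bind κ = μ) (n : ℕ) : chainLaw κ μ n = μ := by
  induction n with
  | zero => rfl
  | succ n ih => rw [chainLaw, ih, h]

/-- The ergodic theorem for a chain that satisfies a drift condition and that reaches some state
from every state in every sufficiently large number of steps. -/
theorem exists_tendsto_expect_chainLaw [Countable α] (hA : IsClosedSet κ A) {x₀ : α}
    (hx₀ : x₀ ∈ A) (hV : ∀ x, V x ≠ ∞) (hw : ∀ x, w x ≠ ∞) (hc : c ≠ ∞)
    (hdrift : ∀ x ∈ A, expect (κ x) V + w x ≤ V x + c)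
    (hfin : ∀ n : ℕ, {x ∈ A | w x ≤ n}.Finite) {z : α}
    (hz : ∀ x ∈ A, ∀ᶠ n in atTop, chainLaw κ (PMF.pure x) n z ≠ 0) :
    ∃ μ : PMF α, μ.support ⊆ A ∧ expect μ w ≠ ∞ ∧ ∀ ν : PMF α, ν.support ⊆ A →
      ∀ f : α → ℝ≥0∞, (∀ x, f x ≤ 1) →
        Tendsto (fun n => expect (chainLaw κ ν n) f) atTop (𝓝 (expect μ f)) := by
  obtain ⟨μ, hμA, hμ, hμw⟩ := exists_stationary hA hx₀ (hV x₀) hw hc hdrift hfin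
  refine ⟨μ, hμA, hμw, fun ν hν f hf => ?_⟩
  -- Outside this set `w x + w y` exceeds the two drift constants by at least 1, so `V x + V y`
  -- decreases by 1 in mean.
  set C : Set (α × α) := {p | w p.1 + w p.2 < c + c + 1} with hCdef
  have hC : (C ∩ A ×ˢ A).Finite := by
    obtain ⟨n, hn⟩ := ENNReal.exists_nat_gt (r := c + c + 1) (by simp [hc])
    refine ((hfin n).prod (hfin n)).subset ?_
    rintro ⟨x, y⟩ ⟨hxy, hx, hy⟩
    have hlt : w x + w y < c + c + 1 := hxy
    exact ⟨⟨hx, (le_self_add.trans hlt.le).trans hn.le⟩,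
      ⟨hy, (le_add_self.trans hlt.le).trans hn.le⟩⟩
  have hdrift2 : ∀ x ∈ A, ∀ y ∈ A, (x, y) ∉ C →
      expect (κ x) V + expect (κ y) V + 1 ≤ V x + V y := by
    intro x hx y hy hxy
    have hge : c + c + 1 ≤ w x + w y := not_lt.1 hxy
    have h2c : c + c ≠ ∞ := by simp [hc]
    refine (ENNReal.add_le_add_iff_right h2c).1 ?_
    calc expect (κ x) V + expect (κ y) V + 1 + (c + c)
        = expect (κ x) V + expect (κ y) V + (c + c + 1) := by ring
      _ ≤ expect (κ x) V + expect (κ y) V + (w x + w y) := by gcongr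
      _ = (expect (κ x) V + w x) + (expect (κ y) V + w y) := by ring
      _ ≤ (V x + c) + (V y + c) := add_le_add (hdrift x hx) (hdrift y hy)
      _ = V x + V y + (c + c) := by ring
  have hgap := limGap_eq_zero hA hV hdrift2 hC hz hf
  have hcouple : ∀ ρ σ : PMF α, ρ.support ⊆ A → σ.support ⊆ A →
      Tendsto (fun n => expect ρ fun x => expect σ fun y => gap κ f n x y) atTop (𝓝 0) := by
    intro ρ σ hρ hσ
    refine tendsto_of_le_liminf_of_limsup_le zero_le ?_
    refine (limsup_expect_gap_le κ hf ρ σ).trans (le_of_eq ?_)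
    rw [← expect_const ρ 0]
    refine expect_congr_of_support fun x hx => ?_
    rw [← expect_const σ 0]
    exact expect_congr_of_support fun y hy => hgap x (hρ hx) y (hσ hy)
  have hup : ∀ n, expect (chainLaw κ ν n) f ≤
      expect μ f + expect ν fun x => expect μ fun y => gap κ f n x y := fun n => by
    simpa [chainLaw_stationary hμ] using expect_chainLaw_le κ f n ν μ
  have hlow : ∀ n, expect μ f - (expect μ fun x => expect ν fun y => gap κ f n x y) ≤
      expect (chainLaw κ ν n) f := fun n => by
    rw [tsub_le_iff_right]
    simpa [chainLaw_stationary hμ] using expect_chainLaw_le κ f n μ ν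
  have hftop : expect μ f ≠ ∞ := by
    refine ne_top_of_le_ne_top ENNReal.one_ne_top ?_
    simpa using expect_mono (μ := μ) hf
  have h1 := (hcouple ν μ hν hμA).const_add (expect μ f)
  have h2 := ENNReal.Tendsto.sub (tendsto_const_nhds (x := expect μ f) (f := atTop))
    (hcouple μ ν hμA hν) (Or.inl hftop)
  rw [add_zero] at h1
  rw [tsub_zero] at h2
  exact tendsto_of_tendsto_of_tendsto_of_le_of_le h2 h1 hlow hup

end Stationary

/-! ### Binomial laws and arrival laws -/

theorem binomialPMF_apply (n : ℕ) (p : unitInterval) (k : ℕ) :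
    binomialPMF n p k = ENNReal.ofReal ((n.choose k : ℝ) * (p : ℝ) ^ k * (1 - (p : ℝ)) ^ (n - k)) := by
  rw [binomialPMF, Measure.toPMF_apply, ProbabilityTheory.binomial_singleton]

theorem le_of_mem_support_binomialPMF {n : ℕ} {p : unitInterval} {k : ℕ}
    (hk : k ∈ (binomialPMF n p).support) : k ≤ n := by
  by_contra! h
  exact hk (by simp [binomialPMF_apply, Nat.choose_eq_zero_of_lt h])

theorem mem_support_binomialPMF {n : ℕ} {p : unitInterval} (h0 : 0 < p) (h1 : p < 1) {k : ℕ} :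
    k ∈ (binomialPMF n p).support ↔ k ≤ n := by
  refine ⟨le_of_mem_support_binomialPMF, fun hk => ?_⟩
  have hp0 : (0 : ℝ) < p := h0
  have hp1 : (p : ℝ) < 1 := h1
  have hc : (0 : ℝ) < n.choose k := by exact_mod_cast Nat.choose_pos hk
  have hq : (0 : ℝ) < 1 - (p : ℝ) := by linarith
  rw [PMF.mem_support_iff, binomialPMF_apply, ← pos_iff_ne_zero, ENNReal.ofReal_pos]
  positivity

theorem rate_eq_toReal {K : ℕ} (arr : UserPair K → PMF ℕ) (e : UserPair K) :
    rate arr e = (expect (arr e) fun k => (k : ℝ≥0∞)).toReal := by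
  rw [rate, expect, ENNReal.tsum_toReal_eq fun k =>
    ENNReal.mul_ne_top ((arr e).apply_ne_top k) (by simp)]
  simp

theorem expect_arr_ne_top {K : ℕ} {arr : UserPair K → PMF ℕ} (h : FiniteSecondMoments arr)
    (e : UserPair K) : expect (arr e) (fun k => (k : ℝ≥0∞)) ≠ ∞ := by
  refine ne_top_of_le_ne_top (h e).ne (expect_mono fun k => ?_)
  exact_mod_cast Nat.le_self_pow two_ne_zero k

theorem expect_arr {K : ℕ} {arr : UserPair K → PMF ℕ} (h : FiniteSecondMoments arr)
    (e : UserPair K) : expect (arr e) (fun k => (k : ℝ≥0∞)) = ENNReal.ofReal (rate arr e) := by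
  rw [rate_eq_toReal, ENNReal.ofReal_toReal (expect_arr_ne_top h e)]

theorem rate_nonneg {K : ℕ} (arr : UserPair K → PMF ℕ) (e : UserPair K) : 0 ≤ rate arr e := by
  rw [rate_eq_toReal]
  exact ENNReal.toReal_nonneg

theorem eq_pure_zero_of_rate_eq_zero {K : ℕ} {arr : UserPair K → PMF ℕ}
    (h : FiniteSecondMoments arr) {e : UserPair K} (he : rate arr e = 0) :
    arr e = PMF.pure 0 := by
  have h0 : expect (arr e) (fun k => (k : ℝ≥0∞)) = 0 := by simp [expect_arr h, he]
  refine (pmf_eq_of_le fun k => ?_).symm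
  by_cases hk : k = 0
  · subst hk
    have hsupp : (arr e).support = {0} := by
      refine Set.eq_singleton_iff_nonempty_unique_mem.2 ⟨(arr e).support_nonempty, fun k hk => ?_⟩
      have h1 := ENNReal.tsum_eq_zero.1 h0 k
      simpa using (mul_eq_zero.1 h1).resolve_left hk
    rw [((arr e).apply_eq_one_iff 0).2 hsupp]
    exact PMF.coe_le_one _ _
  · simp [PMF.pure_apply, hk]

theorem exists_mem_support_pos_of_rate_pos {K : ℕ} {arr : UserPair K → PMF ℕ} {e : UserPair K}
    (he : 0 < rate arr e) : ∃ k ∈ (arr e).support, 0 < k := by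
  by_contra! hk
  have h0 : expect (arr e) (fun k => (k : ℝ≥0∞)) = 0 := by
    rw [← expect_const (arr e) 0]
    exact expect_congr_of_support fun k hk' => by simpa using hk k hk'
  rw [rate_eq_toReal, h0] at he
  simp at he

/-! ### One slot of the switch: mean service and drift -/

namespace Switch

variable {K : ℕ} (S : Switch K)

/-- This uses `0 < p_i < 1`. In particular the state without any entanglement has positive
probability. -/
theorem mem_support_linkLaw {a : Fin K → ℕ} : a ∈ S.linkLaw.support ↔ a ∈ S.linkStates := by
  simp [linkLaw, linkStates, mem_support_prodPMF, mem_support_binomialPMF, S.p_pos, S.p_lt_one,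
    -PMF.mem_support_iff]

/-- The expectation over the link-level entanglements as a finite sum. -/
def linkMean (g : (Fin K → ℕ) → ℝ) : ℝ := ∑ a ∈ S.linkStates, (S.linkLaw a).toReal * g a

theorem expect_linkLaw {g : (Fin K → ℕ) → ℝ} (hg : ∀ a, 0 ≤ g a) :
    expect S.linkLaw (fun a => ENNReal.ofReal (g a)) = ENNReal.ofReal (S.linkMean g) := by
  rw [expect, tsum_eq_sum (s := S.linkStates), linkMean, ENNReal.ofReal_sum_of_nonneg]
  · refine Finset.sum_congr rfl fun a _ => ?_
    rw [ENNReal.ofReal_mul ENNReal.toReal_nonneg, ENNReal.ofReal_toReal (PMF.apply_ne_top _ _)]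
  · exact fun a _ => mul_nonneg ENNReal.toReal_nonneg (hg a)
  · intro a ha
    rw [← S.mem_support_linkLaw, PMF.mem_support_iff, not_not] at ha
    simp [ha]

theorem linkMean_const (c : ℝ) : S.linkMean (fun _ => c) = c := by
  have h1 : S.linkMean (fun _ => 1) = 1 := by
    have h := S.expect_linkLaw (g := fun _ => 1) fun _ => zero_le_one
    rw [ENNReal.ofReal_one, expect_const] at h
    have h2 := congrArg ENNReal.toReal h
    rw [ENNReal.toReal_ofReal] at h2
    · simpa using h2.symm
    · exact Finset.sum_nonneg fun a _ => mul_nonneg ENNReal.toReal_nonneg zero_le_one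
  simp only [linkMean, mul_one] at h1
  rw [linkMean, ← Finset.sum_mul, h1, one_mul]

theorem linkMean_mono {g h : (Fin K → ℕ) → ℝ} (hgh : ∀ a ∈ S.linkStates, g a ≤ h a) :
    S.linkMean g ≤ S.linkMean h :=
  Finset.sum_le_sum fun a ha => mul_le_mul_of_nonneg_left (hgh a ha) ENNReal.toReal_nonneg

theorem linkMean_nonneg {g : (Fin K → ℕ) → ℝ} (hg : ∀ a, 0 ≤ g a) : 0 ≤ S.linkMean g :=
  Finset.sum_nonneg fun a _ => mul_nonneg ENNReal.toReal_nonneg (hg a)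

theorem linkMean_add (g h : (Fin K → ℕ) → ℝ) :
    S.linkMean (fun a => g a + h a) = S.linkMean g + S.linkMean h := by
  simp [linkMean, mul_add, Finset.sum_add_distrib]

theorem linkMean_const_mul (c : ℝ) (g : (Fin K → ℕ) → ℝ) :
    S.linkMean (fun a => c * g a) = c * S.linkMean g := by
  simp only [linkMean, Finset.mul_sum]
  exact Finset.sum_congr rfl fun a _ => by ring

theorem linkMean_sum {ι : Type*} (s : Finset ι) (g : ι → (Fin K → ℕ) → ℝ) :
    S.linkMean (fun a => ∑ i ∈ s, g i a) = ∑ i ∈ s, S.linkMean (g i) := by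
  simp only [linkMean, Finset.mul_sum]
  exact Finset.sum_comm

theorem linkMean_eq_sum_filter {g : (Fin K → ℕ) → ℝ} (hg : g 0 = 0) :
    S.linkMean g = ∑ a ∈ S.linkStates.filter (fun a => a ≠ 0), (S.linkLaw a).toReal * g a := by
  rw [linkMean, Finset.sum_filter]
  refine Finset.sum_congr rfl fun a _ => ?_
  split_ifs with h
  · rfl
  · rw [not_not.1 h, hg, mul_zero]

theorem meanYield_nonneg (x : ℕ) : 0 ≤ S.meanYield x :=
  Finset.sum_nonneg fun _ _ => mul_nonneg (Nat.cast_nonneg _) ENNReal.toReal_nonneg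

theorem expect_yield (x : ℕ) :
    expect (S.yield x) (fun y => (y : ℝ≥0∞)) = ENNReal.ofReal (S.meanYield x) := by
  rw [expect, tsum_eq_sum (s := Finset.range (x + 1)), meanYield, ENNReal.ofReal_sum_of_nonneg]
  · refine Finset.sum_congr rfl fun y _ => ?_
    rw [ENNReal.ofReal_mul (Nat.cast_nonneg _), ENNReal.ofReal_toReal (PMF.apply_ne_top _ _),
      ENNReal.ofReal_natCast, mul_comm]
  · exact fun y _ => mul_nonneg (Nat.cast_nonneg _) ENNReal.toReal_nonneg
  · intro y hy
    have : S.yield x y = 0 := by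
      rw [PMF.apply_eq_zero_iff]
      exact fun h => hy (Finset.mem_range.2 (Nat.lt_succ_of_le (S.yield_le x y h)))
    simp [this]

theorem Hhat_term_nonneg (e : UserPair K) (k l : ℕ) :
    0 ≤ S.meanYield l * (k.choose l : ℝ) * (S.q e : ℝ) ^ l * (1 - (S.q e : ℝ)) ^ (k - l) := by
  have h0 := (S.q e).2.1
  have h1 := sub_nonneg.2 (S.q e).2.2
  have := S.meanYield_nonneg l
  positivity

theorem Hhat_nonneg (e : UserPair K) (k : ℕ) : 0 ≤ S.Hhat e k :=
  Finset.sum_nonneg fun l _ => S.Hhat_term_nonneg e k l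

theorem expect_binomialPMF_meanYield (e : UserPair K) (k : ℕ) :
    expect (binomialPMF k (S.q e)) (fun l => ENNReal.ofReal (S.meanYield l)) =
      ENNReal.ofReal (S.Hhat e k) := by
  rw [expect, tsum_eq_sum (s := Finset.range (k + 1)), Hhat, ENNReal.ofReal_sum_of_nonneg]
  · refine Finset.sum_congr rfl fun l _ => ?_
    rw [binomialPMF_apply, ← ENNReal.ofReal_mul' (S.meanYield_nonneg l)]
    congr 1
    ring
  · exact fun l _ => S.Hhat_term_nonneg e k l
  · intro l hl
    have : binomialPMF k (S.q e) l = 0 := by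
      rw [PMF.apply_eq_zero_iff]
      exact fun h => hl (Finset.mem_range.2 (Nat.lt_succ_of_le (le_of_mem_support_binomialPMF h)))
    simp [this]

theorem Hhat_zero (e : UserPair K) : S.Hhat e 0 = 0 := by
  simp [Hhat, meanYield]

/-- The law of the numbers of delivered pairs when `m e` swaps are attempted for each pair `e`. -/
def deliveryLaw (m : PairVec K) : PMF (PairVec K) :=
  (prodPMF fun e => binomialPMF (m e) (S.q e)).bind fun B => prodPMF fun e => S.yield (B e)

theorem le_of_mem_support_deliveryLaw {m D : PairVec K} (hD : D ∈ (S.deliveryLaw m).support)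
    (e : UserPair K) : D e ≤ m e := by
  obtain ⟨B, hB, hBD⟩ := (PMF.mem_support_bind_iff _ _ _).1 hD
  exact (S.yield_le _ _ (mem_support_prodPMF.1 hBD e)).trans
    (le_of_mem_support_binomialPMF (mem_support_prodPMF.1 hB e))

theorem expect_deliveryLaw (m : PairVec K) (e : UserPair K) :
    expect (S.deliveryLaw m) (fun D => (D e : ℝ≥0∞)) = ENNReal.ofReal (S.Hhat e (m e)) := by
  rw [deliveryLaw, expect_bind]
  simp_rw [expect_prodPMF_eval (fun e => S.yield _) e fun y => (y : ℝ≥0∞), expect_yield]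
  rw [expect_prodPMF_eval (fun e => binomialPMF (m e) (S.q e)) e
    fun l => ENNReal.ofReal (S.meanYield l), expect_binomialPMF_meanYield]

theorem Hhat_le (e : UserPair K) (k : ℕ) : S.Hhat e k ≤ k := by
  have h : expect (S.deliveryLaw fun _ => k) (fun D => (D e : ℝ≥0∞)) ≤ (k : ℝ≥0∞) := by
    rw [← expect_const (S.deliveryLaw fun _ => k) (k : ℝ≥0∞)]
    exact expect_mono_of_support fun D hD => by
      exact_mod_cast S.le_of_mem_support_deliveryLaw hD e
  rw [expect_deliveryLaw, ← ENNReal.ofReal_natCast] at h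
  exact (ENNReal.ofReal_le_ofReal_iff (Nat.cast_nonneg _)).1 h

/-- The numbers of swaps attempted under the policy `W`. -/
def attempts (W : Policy K) (Q : PairVec K) (a : Fin K → ℕ) : PairVec K :=
  fun e => min (W Q a e) (Q e)

theorem step_eq (W : Policy K) (arr : UserPair K → PMF ℕ) (Q : PairVec K) :
    S.step W arr Q = S.linkLaw.bind fun a => (S.deliveryLaw (attempts W Q a)).bind fun D =>
      (prodPMF arr).map fun A => fun e => Q e - D e + A e := by
  simp only [step, deliveryLaw, PMF.bind_bind, attempts]

theorem expect_step (W : Policy K) (arr : UserPair K → PMF ℕ) (Q : PairVec K)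
    (F : PairVec K → ℝ≥0∞) :
    expect (S.step W arr Q) F = expect S.linkLaw fun a =>
      expect (S.deliveryLaw (attempts W Q a)) fun D =>
        expect (prodPMF arr) fun A => F fun e => Q e - D e + A e := by
  simp only [step_eq, expect_bind, expect_map]

theorem queueLaw_eq_chainLaw (W : Policy K) (arr : UserPair K → PMF ℕ) (ν : PMF (PairVec K))
    (n : ℕ) : S.queueLaw W arr ν n = chainLaw (S.step W arr) ν n := by
  induction n with
  | zero => rfl
  | succ n ih => rw [queueLaw, chainLaw, ih]

/-- The mean number of pairs delivered for `e` in a slot that starts with the queues `Q`. -/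
def serviceRate (W : Policy K) (Q : PairVec K) (e : UserPair K) : ℝ :=
  S.linkMean fun a => S.Hhat e (attempts W Q a e)

theorem serviceRate_nonneg (W : Policy K) (Q : PairVec K) (e : UserPair K) :
    0 ≤ S.serviceRate W Q e :=
  S.linkMean_nonneg fun _ => S.Hhat_nonneg _ _

theorem expect_service (W : Policy K) (Q : PairVec K) (e : UserPair K) :
    expect S.linkLaw (fun a => expect (S.deliveryLaw (attempts W Q a)) fun D => (D e : ℝ≥0∞)) =
      ENNReal.ofReal (S.serviceRate W Q e) := by
  simp only [expect_deliveryLaw]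
  exact S.expect_linkLaw fun _ => S.Hhat_nonneg _ _

variable {S}

theorem allocation_le {W : Policy K} (hW : S.IsMaxWeight W) (Q : PairVec K) {a : Fin K → ℕ}
    (ha : a ∈ S.linkStates) (e : UserPair K) : W Q a e ≤ S.alphaMax := by
  have h1 := (Finset.mem_filter.1 (hW Q a ha).1).1
  have h2 := Finset.mem_range.1 (Fintype.mem_piFinset.1 h1 e)
  have h3 := Finset.mem_range.1 (Fintype.mem_piFinset.1 ha e.1.1)
  omega

theorem isClosedSet_admissible (W : Policy K) (arr : UserPair K → PMF ℕ) :
    IsClosedSet (S.step W arr) {x | Admissible arr x} := by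
  intro x hx y hy e he
  rw [step_eq] at hy
  simp only [PMF.mem_support_bind_iff, PMF.mem_support_map_iff] at hy
  obtain ⟨a, -, D, -, A, hA, rfl⟩ := hy
  have h1 := mem_support_prodPMF.1 hA e
  rw [he, PMF.mem_support_pure_iff] at h1
  simp [hx e he, h1]

/-- The drift of the quadratic Lyapunov function. -/
theorem expect_step_sq_add_le {W : Policy K} (hW : S.IsMaxWeight W) (arr : UserPair K → PMF ℕ)
    (Q : PairVec K) :
    expect (S.step W arr Q) (fun x => ∑ e, (x e : ℝ≥0∞) ^ 2) +
        ∑ e, 2 * (Q e : ℝ≥0∞) * ENNReal.ofReal (S.serviceRate W Q e) ≤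
      ∑ e, (Q e : ℝ≥0∞) ^ 2 +
        ∑ e, 2 * (Q e : ℝ≥0∞) * expect (arr e) (fun k => (k : ℝ≥0∞)) +
        ∑ e, ((S.alphaMax : ℝ≥0∞) ^ 2 + expect (arr e) fun k => (k : ℝ≥0∞) ^ 2) := by
  -- The expansion of `(x - D + A) ^ 2` with the negative cross term moved to the left, so that it
  -- makes sense in `ℝ≥0∞`. The remainder `(A - D) ^ 2` is at most `M ^ 2 + A ^ 2`.
  have hpt : ∀ x D A M : ℕ, D ≤ x → D ≤ M →
      ((x - D + A : ℕ) : ℝ≥0∞) ^ 2 + 2 * (x : ℝ≥0∞) * D ≤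
        (x : ℝ≥0∞) ^ 2 + 2 * (x : ℝ≥0∞) * A + ((M : ℝ≥0∞) ^ 2 + (A : ℝ≥0∞) ^ 2) := by
    intro x D A M h1 h2
    obtain ⟨y, rfl⟩ := Nat.exists_eq_add_of_le h1
    obtain ⟨N, rfl⟩ := Nat.exists_eq_add_of_le h2
    norm_cast
    rw [Nat.add_sub_cancel_left]
    nlinarith [Nat.zero_le (D * A), Nat.zero_le (D * N), Nat.zero_le (N * N)]
  calc expect (S.step W arr Q) (fun x => ∑ e, (x e : ℝ≥0∞) ^ 2) +
        ∑ e, 2 * (Q e : ℝ≥0∞) * ENNReal.ofReal (S.serviceRate W Q e)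
      = expect S.linkLaw (fun a => expect (S.deliveryLaw (attempts W Q a)) fun D =>
          expect (prodPMF arr) fun A => ∑ e, (((Q e - D e + A e : ℕ) : ℝ≥0∞) ^ 2 +
            2 * (Q e : ℝ≥0∞) * (D e : ℝ≥0∞))) := by
        simp only [expect_step, ← expect_service, Finset.sum_add_distrib, expect_add,
          expect_finset_sum, expect_const_mul, expect_const]
    _ ≤ expect S.linkLaw (fun a => expect (S.deliveryLaw (attempts W Q a)) fun D =>
          expect (prodPMF arr) fun A => ∑ e, ((Q e : ℝ≥0∞) ^ 2 + 2 * (Q e : ℝ≥0∞) * (A e : ℝ≥0∞) +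
            ((S.alphaMax : ℝ≥0∞) ^ 2 + (A e : ℝ≥0∞) ^ 2))) := by
        refine expect_mono_of_support fun a ha => expect_mono_of_support fun D hD =>
          expect_mono fun A => Finset.sum_le_sum fun e _ => ?_
        have hDe := S.le_of_mem_support_deliveryLaw hD e
        exact hpt _ _ _ _ (hDe.trans (min_le_right _ _)) ((hDe.trans (min_le_left _ _)).trans
          (allocation_le hW Q (S.mem_support_linkLaw.1 ha) e))
    _ = _ := by
        simp only [Finset.sum_add_distrib, expect_add, expect_finset_sum, expect_const_mul,
          expect_const, expect_prodPMF_eval arr _ (fun k => (k : ℝ≥0∞)),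
          expect_prodPMF_eval arr _ (fun k => (k : ℝ≥0∞) ^ 2)]

/-- The exact drift of a linear function. -/
theorem expect_step_linear_add (W : Policy K) (arr : UserPair K → PMF ℕ) (Q : PairVec K)
    (v : UserPair K → ℝ≥0∞) :
    expect (S.step W arr Q) (fun x => ∑ e, v e * (x e : ℝ≥0∞)) +
        ∑ e, v e * ENNReal.ofReal (S.serviceRate W Q e) =
      ∑ e, v e * (Q e : ℝ≥0∞) + ∑ e, v e * expect (arr e) (fun k => (k : ℝ≥0∞)) := by
  calc _ = expect S.linkLaw (fun a => expect (S.deliveryLaw (attempts W Q a)) fun D =>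
          expect (prodPMF arr) fun A => ∑ e, (v e * ((Q e - D e + A e : ℕ) : ℝ≥0∞) +
            v e * (D e : ℝ≥0∞))) := by
        simp only [expect_step, ← expect_service, Finset.sum_add_distrib, expect_add,
          expect_finset_sum, expect_const_mul, expect_const]
    _ = expect S.linkLaw (fun a => expect (S.deliveryLaw (attempts W Q a)) fun D =>
          expect (prodPMF arr) fun A => ∑ e, (v e * (Q e : ℝ≥0∞) + v e * (A e : ℝ≥0∞))) := by
        refine expect_congr_of_support fun a ha => expect_congr_of_support fun D hD =>
          expect_congr_of_support fun A _ => Finset.sum_congr rfl fun e _ => ?_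
        have hDe : D e ≤ Q e :=
          (S.le_of_mem_support_deliveryLaw hD e).trans (min_le_right _ _)
        rw [← mul_add, ← mul_add]
        congr 1
        norm_cast
        omega
    _ = _ := by
        simp only [Finset.sum_add_distrib, expect_add, expect_finset_sum, expect_const_mul,
          expect_const, expect_prodPMF_eval arr _ (fun k => (k : ℝ≥0∞))]

end Switch

/-! ### Sufficiency: rates in `Λ^SP` are stabilized -/

namespace Switch

variable {K : ℕ} {S : Switch K} {W : Policy K}

/-- Allocation and attempts differ only where `Q_e < W_e ≤ alphaMax`; by `Hhat_le` such a pair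
contributes at most `alphaMax ^ 2`. -/
theorem sum_weight_le_add (hW : S.IsMaxWeight W) (Q : PairVec K) {a : Fin K → ℕ}
    (ha : a ∈ S.linkStates) :
    ∑ e, S.Hhat e (W Q a e) * (Q e : ℝ) ≤
      ∑ e, S.Hhat e (attempts W Q a e) * (Q e : ℝ) +
        Fintype.card (UserPair K) * (S.alphaMax : ℝ) ^ 2 := by
  have hcard : (Fintype.card (UserPair K) : ℝ) * (S.alphaMax : ℝ) ^ 2 =
      ∑ _e : UserPair K, (S.alphaMax : ℝ) ^ 2 := by simp
  rw [hcard, ← Finset.sum_add_distrib]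
  refine Finset.sum_le_sum fun e _ => ?_
  rcases le_or_gt (W Q a e) (Q e) with h | h
  · rw [attempts, min_eq_left h]
    have : (0 : ℝ) ≤ (S.alphaMax : ℝ) ^ 2 := by positivity
    linarith
  · have h1 : (W Q a e : ℝ) ≤ S.alphaMax := by exact_mod_cast allocation_le hW Q ha e
    have h2 : (Q e : ℝ) ≤ S.alphaMax := by exact_mod_cast h.le.trans (allocation_le hW Q ha e)
    have h3 : S.Hhat e (W Q a e) * (Q e : ℝ) ≤ (S.alphaMax : ℝ) ^ 2 := by
      rw [pow_two]
      exact mul_le_mul ((S.Hhat_le _ _).trans h1) h2 (Nat.cast_nonneg _) (Nat.cast_nonneg _)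
    have h4 : 0 ≤ S.Hhat e (attempts W Q a e) * (Q e : ℝ) :=
      mul_nonneg (S.Hhat_nonneg _ _) (Nat.cast_nonneg _)
    linarith

/-- Inside the capacity region, a max-weight policy serves the queues, weighted by their lengths,
at a rate which exceeds the arrival rate by a fixed factor, up to a constant. -/
theorem exists_sum_mul_rate_le (hW : S.IsMaxWeight W) {lam : UserPair K → ℝ}
    (hlam : lam ∈ S.LambdaSP) :
    ∃ θ : ℝ, 0 < θ ∧ ∀ Q : PairVec K, (1 + θ) * ∑ e, lam e * (Q e : ℝ) ≤
      ∑ e, S.serviceRate W Q e * (Q e : ℝ) +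
        Fintype.card (UserPair K) * (S.alphaMax : ℝ) ^ 2 := by
  obtain ⟨-, b, hb0, hb1, hb⟩ := hlam
  -- Finitely many strict inequalities survive multiplication by `1 + θ` for small `θ`.
  obtain ⟨θ, hθ0, hθ⟩ : ∃ θ : ℝ, 0 < θ ∧
      ∀ a ∈ S.linkStates, (1 + θ) * ∑ π ∈ feasible a, b a π ≤ 1 := by
    have h : ∀ᶠ θ in 𝓝[>] (0 : ℝ), ∀ a ∈ S.linkStates,
        (1 + θ) * ∑ π ∈ feasible a, b a π < 1 := by
      rw [Filter.eventually_all_finset]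
      intro a ha
      have hcont : Tendsto (fun θ : ℝ => (1 + θ) * ∑ π ∈ feasible a, b a π) (𝓝[>] 0)
          (𝓝 ((1 + 0) * ∑ π ∈ feasible a, b a π)) :=
        ((continuous_const.add continuous_id).mul continuous_const).continuousAt.tendsto.mono_left
          nhdsWithin_le_nhds
      exact hcont.eventually_lt_const (by simpa using hb1 a ha)
    obtain ⟨θ, h1, h2⟩ := (h.and self_mem_nhdsWithin).exists
    exact ⟨θ, h2, fun a ha => (h1 a ha).le⟩
  refine ⟨θ, hθ0, fun Q => ?_⟩
  have hθ1 : 0 < 1 + θ := by linarith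
  have hmax : ∀ a ∈ S.linkStates,
      (1 + θ) * ∑ π ∈ feasible a, b a π * ∑ e, S.Hhat e (π e) * (Q e : ℝ) ≤
        ∑ e, S.Hhat e (W Q a e) * (Q e : ℝ) := by
    intro a ha
    set m := ∑ e, S.Hhat e (W Q a e) * (Q e : ℝ) with hm
    have hm0 : 0 ≤ m :=
      Finset.sum_nonneg fun e _ => mul_nonneg (S.Hhat_nonneg _ _) (Nat.cast_nonneg _)
    calc (1 + θ) * ∑ π ∈ feasible a, b a π * ∑ e, S.Hhat e (π e) * (Q e : ℝ)
        ≤ (1 + θ) * ∑ π ∈ feasible a, b a π * m :=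
          mul_le_mul_of_nonneg_left (Finset.sum_le_sum fun π hπ =>
            mul_le_mul_of_nonneg_left ((hW Q a ha).2 π hπ) (hb0 a ha π hπ).le) hθ1.le
      _ = ((1 + θ) * ∑ π ∈ feasible a, b a π) * m := by rw [← Finset.sum_mul, mul_assoc]
      _ ≤ 1 * m := mul_le_mul_of_nonneg_right (hθ a ha) hm0
      _ = m := one_mul m
  calc (1 + θ) * ∑ e, lam e * (Q e : ℝ)
      ≤ (1 + θ) * ∑ e, (∑ a ∈ S.linkStates.filter (fun a => a ≠ 0),
          (S.linkLaw a).toReal * ∑ π ∈ feasible a, b a π * S.Hhat e (π e)) * (Q e : ℝ) :=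
        mul_le_mul_of_nonneg_left (Finset.sum_le_sum fun e _ =>
          mul_le_mul_of_nonneg_right (hb e) (Nat.cast_nonneg _)) hθ1.le
    _ = ∑ a ∈ S.linkStates.filter (fun a => a ≠ 0), (S.linkLaw a).toReal *
          ((1 + θ) * ∑ π ∈ feasible a, b a π * ∑ e, S.Hhat e (π e) * (Q e : ℝ)) := by
        simp only [Finset.mul_sum, Finset.sum_mul]
        rw [Finset.sum_comm]
        refine Finset.sum_congr rfl fun a _ => ?_
        rw [Finset.sum_comm]
        exact Finset.sum_congr rfl fun π _ => Finset.sum_congr rfl fun e _ => by ring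
    _ ≤ ∑ a ∈ S.linkStates.filter (fun a => a ≠ 0), (S.linkLaw a).toReal *
          ∑ e, S.Hhat e (W Q a e) * (Q e : ℝ) :=
        Finset.sum_le_sum fun a ha => mul_le_mul_of_nonneg_left
          (hmax a (Finset.mem_filter.1 ha).1) ENNReal.toReal_nonneg
    _ ≤ S.linkMean fun a => ∑ e, S.Hhat e (W Q a e) * (Q e : ℝ) :=
        Finset.sum_le_sum_of_subset_of_nonneg (Finset.filter_subset _ _) fun a _ _ =>
          mul_nonneg ENNReal.toReal_nonneg (Finset.sum_nonneg fun e _ =>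
            mul_nonneg (S.Hhat_nonneg _ _) (Nat.cast_nonneg _))
    _ ≤ S.linkMean fun a => ∑ e, S.Hhat e (attempts W Q a e) * (Q e : ℝ) +
          Fintype.card (UserPair K) * (S.alphaMax : ℝ) ^ 2 :=
        S.linkMean_mono fun a ha => sum_weight_le_add hW Q ha
    _ = _ := by
        rw [linkMean_add, linkMean_const, linkMean_sum]
        congr 1
        refine Finset.sum_congr rfl fun e _ => ?_
        simp only [mul_comm _ (Q e : ℝ), linkMean_const_mul]
        rfl

variable {arr : UserPair K → PMF ℕ}

/-- Any `η` below all positive rates works: a pair with rate zero never issues a request, so its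
queue is empty in an admissible state. -/
theorem exists_mul_le_rate (harr : FiniteSecondMoments arr) :
    ∃ η : ℝ, 0 < η ∧ ∀ Q : PairVec K, Admissible arr Q →
      η * ∑ e, (Q e : ℝ) ≤ ∑ e, rate arr e * (Q e : ℝ) := by
  have h : ∀ᶠ η in 𝓝[>] (0 : ℝ), ∀ e, 0 < rate arr e → η < rate arr e := by
    rw [Filter.eventually_all]
    intro e
    by_cases he : 0 < rate arr e
    · filter_upwards [nhdsWithin_le_nhds (gt_mem_nhds he)] with η hη _ using hη
    · exact Eventually.of_forall fun _ h => absurd h he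
  obtain ⟨η, h1, h2⟩ := (h.and self_mem_nhdsWithin).exists
  refine ⟨η, h2, fun Q hQ => ?_⟩
  rw [Finset.mul_sum]
  refine Finset.sum_le_sum fun e _ => ?_
  rcases (rate_nonneg arr e).eq_or_lt with he | he
  · simp [hQ e (eq_pure_zero_of_rate_eq_zero harr he.symm)]
  · exact mul_le_mul_of_nonneg_right (h1 e he).le (Nat.cast_nonneg _)

/-- Negative drift of the quadratic Lyapunov function for arrival rates in the capacity region. -/
theorem exists_drift (hW : S.IsMaxWeight W) (harr : FiniteSecondMoments arr)
    (hlam : rate arr ∈ S.LambdaSP) :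
    ∃ η c : ℝ≥0∞, η ≠ 0 ∧ η ≠ ∞ ∧ c ≠ ∞ ∧ ∀ Q : PairVec K, Admissible arr Q →
      expect (S.step W arr Q) (fun x => ∑ e, (x e : ℝ≥0∞) ^ 2) + η * ∑ e, (Q e : ℝ≥0∞) ≤
        ∑ e, (Q e : ℝ≥0∞) ^ 2 + c := by
  obtain ⟨θ, hθ, hdrift⟩ := exists_sum_mul_rate_le hW hlam
  obtain ⟨ρ, hρ, hrate⟩ := exists_mul_le_rate harr
  set C : ℝ := Fintype.card (UserPair K) * (S.alphaMax : ℝ) ^ 2 with hC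
  have hC0 : 0 ≤ C := by positivity
  set c₁ : ℝ≥0∞ :=
    ∑ e, ((S.alphaMax : ℝ≥0∞) ^ 2 + expect (arr e) fun k => (k : ℝ≥0∞) ^ 2) with hc₁
  have hc₁top : c₁ ≠ ∞ := by
    refine ENNReal.sum_ne_top.2 fun e _ => ENNReal.add_ne_top.2 ⟨by simp, (harr e).ne⟩
  -- The factor 2 comes from the cross terms of the squares, `θ` from the service slack and `ρ` from
  -- the comparison of `∑ rate * Q` with `∑ Q`.
  refine ⟨ENNReal.ofReal (2 * (θ * ρ)), c₁ + ENNReal.ofReal (2 * C), ?_, ENNReal.ofReal_ne_top,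
    ENNReal.add_ne_top.2 ⟨hc₁top, ENNReal.ofReal_ne_top⟩, fun Q hQ => ?_⟩
  · simpa using mul_pos hθ hρ
  have hreal : ∑ e, 2 * (Q e : ℝ) * rate arr e + 2 * (θ * ρ) * ∑ e, (Q e : ℝ) ≤
      ∑ e, 2 * (Q e : ℝ) * S.serviceRate W Q e + 2 * C := by
    have h1 := hdrift Q
    have h2 := mul_le_mul_of_nonneg_left (hrate Q hQ) hθ.le
    have e1 : ∑ e, 2 * (Q e : ℝ) * rate arr e = 2 * ∑ e, rate arr e * (Q e : ℝ) := by
      rw [Finset.mul_sum]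
      exact Finset.sum_congr rfl fun e _ => by ring
    have e2 : ∑ e, 2 * (Q e : ℝ) * S.serviceRate W Q e =
        2 * ∑ e, S.serviceRate W Q e * (Q e : ℝ) := by
      rw [Finset.mul_sum]
      exact Finset.sum_congr rfl fun e _ => by ring
    rw [e1, e2]
    linarith
  have hcast : ∀ v : UserPair K → ℝ, (∀ e, 0 ≤ v e) →
      ENNReal.ofReal (∑ e, 2 * (Q e : ℝ) * v e) =
        ∑ e, 2 * (Q e : ℝ≥0∞) * ENNReal.ofReal (v e) := by
    intro v hv
    rw [ENNReal.ofReal_sum_of_nonneg fun e _ => by have := hv e; positivity]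
    refine Finset.sum_congr rfl fun e _ => ?_
    rw [ENNReal.ofReal_mul (by positivity), ENNReal.ofReal_mul (by positivity),
      ENNReal.ofReal_natCast, ENNReal.ofReal_ofNat]
  have hsumQ : ENNReal.ofReal (∑ e, (Q e : ℝ)) = ∑ e, (Q e : ℝ≥0∞) := by
    rw [ENNReal.ofReal_sum_of_nonneg fun e _ => Nat.cast_nonneg _]
    simp
  have henn : ∑ e, 2 * (Q e : ℝ≥0∞) * ENNReal.ofReal (rate arr e) +
      ENNReal.ofReal (2 * (θ * ρ)) * ∑ e, (Q e : ℝ≥0∞) ≤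
        ∑ e, 2 * (Q e : ℝ≥0∞) * ENNReal.ofReal (S.serviceRate W Q e) + ENNReal.ofReal (2 * C) := by
    have h := ENNReal.ofReal_le_ofReal hreal
    rw [ENNReal.ofReal_add, ENNReal.ofReal_add, ENNReal.ofReal_mul (by positivity),
      hcast _ (rate_nonneg arr), hcast _ (S.serviceRate_nonneg W Q), hsumQ] at h
    · exact h
    · exact Finset.sum_nonneg fun e _ => by
        have := S.serviceRate_nonneg W Q e
        positivity
    · positivity
    · exact Finset.sum_nonneg fun e _ => by
        have := rate_nonneg arr e
        positivity
    · positivity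
  have hquad := expect_step_sq_add_le hW arr Q
  simp only [expect_arr harr] at hquad
  set EV := expect (S.step W arr Q) (fun x => ∑ e, (x e : ℝ≥0∞) ^ 2)
  set X := ∑ e, 2 * (Q e : ℝ≥0∞) * ENNReal.ofReal (rate arr e) with hX
  set Y := ∑ e, 2 * (Q e : ℝ≥0∞) * ENNReal.ofReal (S.serviceRate W Q e)
  -- The arrival term `X` is finite, so it can be added to both sides and cancelled.
  have hXtop : X ≠ ∞ := ENNReal.sum_ne_top.2 fun e _ =>
    ENNReal.mul_ne_top (ENNReal.mul_ne_top (by simp) (by simp)) (by simp)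
  refine (ENNReal.add_le_add_iff_right hXtop).1 ?_
  calc EV + ENNReal.ofReal (2 * (θ * ρ)) * ∑ e, (Q e : ℝ≥0∞) + X
      = EV + (X + ENNReal.ofReal (2 * (θ * ρ)) * ∑ e, (Q e : ℝ≥0∞)) := by ring
    _ ≤ EV + (Y + ENNReal.ofReal (2 * C)) := by gcongr
    _ = (EV + Y) + ENNReal.ofReal (2 * C) := by ring
    _ ≤ (∑ e, (Q e : ℝ≥0∞) ^ 2 + X + c₁) + ENNReal.ofReal (2 * C) := by gcongr
    _ = _ := by ring

theorem finite_setOf_sum_le {η : ℝ≥0∞} (hη : η ≠ 0) {R : ℝ≥0∞} (hR : R ≠ ∞) :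
    {x : PairVec K | η * ∑ e, (x e : ℝ≥0∞) ≤ R}.Finite := by
  obtain ⟨n, hn⟩ := ENNReal.exists_nat_gt (ENNReal.div_ne_top hR hη)
  refine (Set.finite_Iic (fun _ : UserPair K => n)).subset fun x hx e => ?_
  have h1 : (∑ e, (x e : ℝ≥0∞)) * η ≤ R := by simpa [mul_comm] using hx
  have h2 : (x e : ℝ≥0∞) * η ≤ R :=
    (mul_le_mul_left (Finset.single_le_sum (f := fun e => (x e : ℝ≥0∞))
      (fun _ _ => zero_le) (Finset.mem_univ e)) η).trans h1
  have h3 : (x e : ℝ≥0∞) ≤ R / η :=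
    ENNReal.le_div_iff_mul_le (Or.inl hη) (Or.inr hR) |>.2 h2
  have h4 : (x e : ℝ≥0∞) ≤ n := h3.trans hn.le
  exact_mod_cast h4

theorem admissible_zero (arr : UserPair K → PMF ℕ) : Admissible arr 0 := fun _ _ => rfl

-- A bounded continuous test function is rescaled by a bound `C` to take values in `[0, 1]`.
open scoped NNReal BoundedContinuousFunction in
theorem tendsto_toProb_of_tendsto_expect {u : ℕ → PMF (PairVec K)} {μ : PMF (PairVec K)}
    (h : ∀ f : PairVec K → ℝ≥0∞, (∀ x, f x ≤ 1) →
      Tendsto (fun n => expect (u n) f) atTop (𝓝 (expect μ f))) :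
    Tendsto (fun n => toProb (u n)) atTop (𝓝 (toProb μ)) := by
  rw [ProbabilityMeasure.tendsto_iff_forall_lintegral_tendsto]
  intro f
  have hexp : ∀ ν : PMF (PairVec K),
      ∫⁻ x, (f x : ℝ≥0∞) ∂((toProb ν : ProbabilityMeasure (PairVec K)) : Measure (PairVec K)) =
        expect ν fun x => (f x : ℝ≥0∞) := fun ν => (expect_eq_lintegral ν _).symm
  simp only [hexp]
  obtain ⟨C, hC0, hC⟩ : ∃ C : ℝ≥0, C ≠ 0 ∧ ∀ x, f x ≤ C := by
    refine ⟨nndist f 0 + 1, by positivity, fun x => ?_⟩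
    have := f.nndist_coe_le_nndist (g := 0) x
    exact (by simpa using this : f x ≤ nndist f 0).trans (by simp)
  have hC0' : (C : ℝ≥0∞) ≠ 0 := by simpa using hC0
  have hscale : ∀ ν : PMF (PairVec K), expect ν (fun x => (f x : ℝ≥0∞)) =
      C * expect ν fun x => (C : ℝ≥0∞)⁻¹ * f x := fun ν => by
    rw [expect_const_mul, ← mul_assoc, ENNReal.mul_inv_cancel hC0' ENNReal.coe_ne_top, one_mul]
  simp only [hscale]
  refine ENNReal.Tendsto.const_mul (h _ fun x => ?_) (Or.inr ENNReal.coe_ne_top)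
  rw [← ENNReal.inv_mul_cancel hC0' ENNReal.coe_ne_top]
  gcongr
  exact hC x

/-- Max-weight scheduling stabilizes the switch for all arrival rates in `Λ^SP`. -/
theorem stable_of_mem_LambdaSP (hW : S.IsMaxWeight W) (harr : FiniteSecondMoments arr)
    (hirr : S.EssentiallyIrreducible W arr) (hlam : rate arr ∈ S.LambdaSP) : S.Stable W arr := by
  obtain ⟨η, c, hη0, hηtop, hc, hdrift⟩ := exists_drift hW harr hlam
  obtain ⟨z, hz⟩ := hirr
  simp only [queueLaw_eq_chainLaw] at hz
  have hsum : ∀ x : PairVec K, ∑ e, (x e : ℝ≥0∞) ≠ ∞ := fun x =>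
    ENNReal.sum_ne_top.2 fun e _ => ENNReal.natCast_ne_top _
  have hsq : ∀ x : PairVec K, ∑ e, (x e : ℝ≥0∞) ^ 2 ≠ ∞ := fun x =>
    ENNReal.sum_ne_top.2 fun e _ => ENNReal.pow_ne_top (ENNReal.natCast_ne_top _)
  have hfin : ∀ n : ℕ,
      {x ∈ {x : PairVec K | Admissible arr x} | η * ∑ e, (x e : ℝ≥0∞) ≤ n}.Finite := fun n =>
    (finite_setOf_sum_le hη0 (ENNReal.natCast_ne_top n)).subset fun x hx => hx.2
  obtain ⟨μ, -, hμw, hμ⟩ := exists_tendsto_expect_chainLaw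
    (isClosedSet_admissible (S := S) W arr) (admissible_zero arr) hsq
    (fun x => ENNReal.mul_ne_top hηtop (hsum x)) hc hdrift hfin hz
  refine ⟨μ, fun ν hν => ?_, fun e => ?_⟩
  · simp only [queueLaw_eq_chainLaw]
    exact tendsto_toProb_of_tendsto_expect fun f hf => hμ ν hν f hf
  · rw [expect_const_mul] at hμw
    have h1 : expect μ (fun x => ∑ e, (x e : ℝ≥0∞)) ≠ ∞ := fun h => by
      rw [h, ENNReal.mul_top hη0] at hμw
      exact hμw rfl
    refine lt_of_le_of_lt (expect_mono (μ := μ) fun x => ?_) (lt_top_iff_ne_top.2 h1)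
    exact Finset.single_le_sum (f := fun e => (x e : ℝ≥0∞)) (fun _ _ => zero_le)
      (Finset.mem_univ e)

end Switch

/-! ### Stationarity of weak limits, and harmonic functions -/

open scoped NNReal BoundedContinuousFunction in
theorem tendsto_expect_of_tendsto_toProb {K : ℕ} {u : ℕ → PMF (PairVec K)} {μ : PMF (PairVec K)}
    (h : Tendsto (fun n => toProb (u n)) atTop (𝓝 (toProb μ))) {f : PairVec K → ℝ≥0∞}
    (hf : ∀ x, f x ≤ 1) : Tendsto (fun n => expect (u n) f) atTop (𝓝 (expect μ f)) := by
  have hfin : ∀ x, f x ≠ ∞ := fun x => ne_top_of_le_ne_top ENNReal.one_ne_top (hf x)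
  have hle : ∀ x, (f x).toNNReal ≤ 1 := fun x => by
    simpa using ENNReal.toNNReal_mono ENNReal.one_ne_top (hf x)
  -- The state space is discrete, so every bounded function is an admissible test function.
  let g : PairVec K →ᵇ ℝ≥0 := BoundedContinuousFunction.mkOfDiscrete (fun x => (f x).toNNReal) 1
    fun x y => by
      rw [NNReal.dist_eq, abs_le]
      have h1 : ((f x).toNNReal : ℝ) ≤ 1 := hle x
      have h2 : ((f y).toNNReal : ℝ) ≤ 1 := hle y
      have h3 : (0 : ℝ) ≤ (f x).toNNReal := NNReal.coe_nonneg _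
      have h4 : (0 : ℝ) ≤ (f y).toNNReal := NNReal.coe_nonneg _
      constructor <;> linarith
  have h1 := (ProbabilityMeasure.tendsto_iff_forall_lintegral_tendsto.1 h) g
  have hexp : ∀ ν : PMF (PairVec K),
      ∫⁻ x, (g x : ℝ≥0∞) ∂((toProb ν : ProbabilityMeasure (PairVec K)) : Measure (PairVec K)) =
        expect ν f := fun ν => by
    rw [expect_eq_lintegral]
    exact lintegral_congr fun x => ENNReal.coe_toNNReal (hfin x)
  simpa only [hexp] using h1

/-- The weak limit of the laws of a chain is stationary. -/
theorem bind_eq_of_tendsto_toProb {K : ℕ} {κ : PairVec K → PMF (PairVec K)}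
    {ν μ : PMF (PairVec K)} (h : Tendsto (fun n => toProb (chainLaw κ ν n)) atTop (𝓝 (toProb μ))) :
    μ.bind κ = μ := by
  classical
  refine PMF.ext fun y => ?_
  -- The probability of `y` at time `n + 1` has two limits: one from testing with `κ · y` at time
  -- `n`, one from testing with the indicator of `y`.
  have h1 := tendsto_expect_of_tendsto_toProb h (f := fun x => κ x y)
    fun x => PMF.coe_le_one _ _
  have h2 := (tendsto_expect_of_tendsto_toProb h (f := fun x => if x = y then 1 else 0)
    fun x => by split_ifs <;> simp).comp (tendsto_add_atTop_nat 1)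
  simp only [Function.comp_def, expect_indicator_singleton] at h2
  exact tendsto_nhds_unique h1 h2

/-- A finite-mean function which does not decrease in mean along a stationary chain is constant
along the chain. -/
theorem eq_of_stationary_of_le_expect {α : Type*} {κ : α → PMF α} {μ : PMF α} (hμ : μ.bind κ = μ)
    {V : α → ℝ≥0∞} (hfin : expect μ V ≠ ∞) (hV : ∀ x ∈ μ.support, V x ≤ expect (κ x) V) :
    ∀ x ∈ μ.support, ∀ y ∈ (κ x).support, V y = V x := by
  have hstat : ∀ f : α → ℝ≥0∞, expect μ (fun x => expect (κ x) f) = expect μ f := fun f => by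
    rw [← expect_bind, hμ]
  have heq := eq_on_support_of_expect_le hV (hstat V).le hfin
  intro x hx
  set m := V x with hm
  have hmtop : m ≠ ∞ := ne_top_of_expect_ne_top hfin hx
  -- Truncation at `m = V x`: as `V` is harmonic on the support, `min V m` is superharmonic there,
  -- hence harmonic by stationarity. At `x` it attains its maximum `m`, so `V ≥ m` at all successors
  -- of `x`; their mean being `m` forces equality.
  have hmin : ∀ x' ∈ μ.support, expect (κ x') (fun y => min (V y) m) ≤ min (V x') m := by
    intro x' hx'
    refine le_min ?_ ?_
    · rw [heq x' hx']
      exact expect_mono fun y => min_le_left _ _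
    · rw [← expect_const (κ x') m]
      exact expect_mono fun y => by simp
  have hminfin : expect μ (fun x' => expect (κ x') fun y => min (V y) m) ≠ ∞ := by
    rw [hstat]
    exact ne_top_of_le_ne_top hfin (expect_mono fun y => min_le_left _ _)
  have h1 := eq_on_support_of_expect_le hmin (hstat _).ge hminfin x hx
  rw [← hm, min_self] at h1
  have h2 : ∀ y ∈ (κ x).support, min (V y) m = m :=
    eq_on_support_of_expect_le (g := fun _ => m) (fun y _ => min_le_right _ _)
      (by rw [expect_const, h1]) (by rw [h1]; exact hmtop)
  have h3 := eq_on_support_of_expect_le (μ := κ x) (f := fun _ => m) (g := V)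
    (fun y hy => min_eq_right_iff.1 (h2 y hy)) (by rw [expect_const, ← heq x hx])
    (by rwa [expect_const])
  exact fun y hy => (h3 y hy).symm

/-! ### Necessity: separation from `Λ^SP` -/

namespace Switch

variable {K : ℕ} {S : Switch K} {W : Policy K}

/-- The mean service of the pair `e` under the time-sharing weights `b`. -/
def sharedRate (S : Switch K) (b : (Fin K → ℕ) → PairVec K → ℝ) (e : UserPair K) : ℝ :=
  ∑ a ∈ S.linkStates.filter (fun a => a ≠ 0),
    (S.linkLaw a).toReal * ∑ π ∈ feasible a, b a π * S.Hhat e (π e)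

/-- Admissible time-sharing weights. -/
def IsWeight (S : Switch K) (b : (Fin K → ℕ) → PairVec K → ℝ) : Prop :=
  (∀ a ∈ S.linkStates, ∀ π ∈ feasible a, 0 < b a π) ∧
    ∀ a ∈ S.linkStates, ∑ π ∈ feasible a, b a π < 1

theorem mem_LambdaSP_iff {lam : UserPair K → ℝ} :
    lam ∈ S.LambdaSP ↔ (∀ e, 0 ≤ lam e) ∧ ∃ b, S.IsWeight b ∧ ∀ e, lam e ≤ S.sharedRate b e := by
  simp only [LambdaSP, IsWeight, sharedRate, Set.mem_ofPred_eq, and_assoc]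

theorem sharedRate_nonneg {b : (Fin K → ℕ) → PairVec K → ℝ} (hb : S.IsWeight b)
    (e : UserPair K) : 0 ≤ S.sharedRate b e :=
  Finset.sum_nonneg fun a ha => mul_nonneg ENNReal.toReal_nonneg <| Finset.sum_nonneg fun π hπ =>
    mul_nonneg (hb.1 a (Finset.mem_filter.1 ha).1 π hπ).le (S.Hhat_nonneg _ _)

theorem sharedRate_combination (b b' : (Fin K → ℕ) → PairVec K → ℝ) (s t : ℝ) (e : UserPair K) :
    S.sharedRate (fun a π => s * b a π + t * b' a π) e =
      s * S.sharedRate b e + t * S.sharedRate b' e := by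
  simp only [sharedRate, Finset.mul_sum, ← Finset.sum_add_distrib]
  exact Finset.sum_congr rfl fun a _ => Finset.sum_congr rfl fun π _ => by ring

theorem IsWeight.combination {b b' : (Fin K → ℕ) → PairVec K → ℝ} (hb : S.IsWeight b)
    (hb' : S.IsWeight b') {s t : ℝ} (hs : 0 ≤ s) (ht : 0 ≤ t) (hst : s + t = 1) :
    S.IsWeight fun a π => s * b a π + t * b' a π := by
  refine ⟨fun a ha π hπ => ?_, fun a ha => ?_⟩
  · exact convex_Ioi (0 : ℝ) (hb.1 a ha π hπ) (hb'.1 a ha π hπ) hs ht hst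
  · rw [Finset.sum_add_distrib, ← Finset.mul_sum, ← Finset.mul_sum]
    exact convex_Iio (1 : ℝ) (hb.2 a ha) (hb'.2 a ha) hs ht hst

open Classical in
/-- Weights close to the deterministic choice `a ↦ π a`. -/
def nearPure (π : (Fin K → ℕ) → PairVec K) (ε : ℝ) (a : Fin K → ℕ) (ρ : PairVec K) : ℝ :=
  (1 - ε) * (if ρ = π a then 1 else 0) + ε * ((feasible a).card + 1 : ℝ)⁻¹

/-- The uniform part makes all weights positive; dividing by `card + 1` instead of `card` keeps the
total strictly below 1. -/
theorem isWeight_nearPure {π : (Fin K → ℕ) → PairVec K} (hπ : ∀ a ∈ S.linkStates, π a ∈ feasible a)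
    {ε : ℝ} (h0 : 0 < ε) (h1 : ε < 1) : S.IsWeight (nearPure π ε) := by
  have h1' : 0 < 1 - ε := sub_pos.2 h1
  refine ⟨fun a _ ρ _ => ?_, fun a ha => ?_⟩
  · rw [nearPure]
    split_ifs <;> positivity
  · simp only [nearPure, Finset.sum_add_distrib, ← Finset.mul_sum]
    rw [Finset.sum_ite_eq' (feasible a) (π a), if_pos (hπ a ha), Finset.sum_const, nsmul_eq_mul]
    have h2 : ((feasible a).card : ℝ) * ((feasible a).card + 1 : ℝ)⁻¹ < 1 := by
      rw [← div_eq_mul_inv, div_lt_one (by positivity)]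
      linarith
    nlinarith

theorem mul_Hhat_le_sharedRate_nearPure {π : (Fin K → ℕ) → PairVec K}
    (hπ : ∀ a ∈ S.linkStates, π a ∈ feasible a) {ε : ℝ} (h0 : 0 < ε) (h1 : ε < 1)
    (e : UserPair K) :
    (1 - ε) * (∑ a ∈ S.linkStates.filter (fun a => a ≠ 0),
      (S.linkLaw a).toReal * S.Hhat e (π a e)) ≤ S.sharedRate (nearPure π ε) e := by
  rw [Finset.mul_sum]
  refine Finset.sum_le_sum fun a ha => ?_
  have ha' := (Finset.mem_filter.1 ha).1
  rw [mul_left_comm]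
  refine mul_le_mul_of_nonneg_left ?_ ENNReal.toReal_nonneg
  refine le_trans ?_ (Finset.single_le_sum (f := fun ρ => nearPure π ε a ρ * S.Hhat e (ρ e))
    (fun ρ hρ => mul_nonneg ((isWeight_nearPure hπ h0 h1).1 a ha' ρ hρ).le (S.Hhat_nonneg _ _))
    (hπ a ha'))
  refine mul_le_mul_of_nonneg_right ?_ (S.Hhat_nonneg _ _)
  simp only [nearPure, if_true, mul_one]
  have : 0 < ε * ((feasible a).card + 1 : ℝ)⁻¹ := by positivity
  linarith

theorem zero_mem_feasible (a : Fin K → ℕ) : (0 : PairVec K) ∈ feasible a := by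
  rw [mem_feasible]
  intro j
  simp [usage]

/-- A rate vector outside of the capacity region is separated from it by a nonnegative functional
which charges some pair with a positive rate. -/
theorem exists_separating {lam : UserPair K → ℝ} (h0 : ∀ e, 0 ≤ lam e)
    (hlam : lam ∉ S.LambdaSP) :
    ∃ v : UserPair K → ℝ, (∀ e, 0 ≤ v e) ∧ (∃ e, 0 < v e ∧ 0 < lam e) ∧
      ∀ b, S.IsWeight b → ∑ e, v e * S.sharedRate b e ≤ ∑ e, v e * lam e := by
  classical
  -- Strict inequalities make `G` open. Pairs with zero rate are left unconstrained, which forces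
  -- the functional to vanish on them.
  set G : Set (UserPair K → ℝ) :=
    {x | ∃ b, S.IsWeight b ∧ ∀ e, 0 < lam e → x e < S.sharedRate b e} with hG
  have hconv : Convex ℝ G := by
    rintro x ⟨b, hb, hx⟩ y ⟨b', hb', hy⟩ s t hs ht hst
    refine ⟨_, hb.combination hb' hs ht hst, fun e he => ?_⟩
    rw [sharedRate_combination]
    have h1 := sub_pos.2 (hx e he)
    have h2 := sub_pos.2 (hy e he)
    have h3 := convex_Ioi (0 : ℝ) h1 h2 hs ht hst
    simp only [smul_eq_mul, Set.mem_Ioi] at h3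
    simp only [Pi.add_apply, Pi.smul_apply, smul_eq_mul]
    linarith
  have hopen : IsOpen G := by
    have : G = ⋃ b ∈ {b | S.IsWeight b}, ⋂ e, {x | 0 < lam e → x e < S.sharedRate b e} := by
      ext x
      simp [hG]
    rw [this]
    refine isOpen_biUnion fun b _ => isOpen_iInter_of_finite fun e => ?_
    by_cases he : 0 < lam e
    · simpa [he] using isOpen_lt (continuous_apply e) continuous_const
    · simp [he]
  have hnot : lam ∉ G := by
    rintro ⟨b, hb, hx⟩
    refine hlam (mem_LambdaSP_iff.2 ⟨h0, b, hb, fun e => ?_⟩)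
    rcases (h0 e).eq_or_lt with he | he
    · rw [← he]
      exact sharedRate_nonneg hb e
    · exact (hx e he).le
  obtain ⟨f, hf⟩ := geometric_hahn_banach_open_point hconv hopen hnot
  set v : UserPair K → ℝ := fun e => f (Pi.single e 1) with hv
  have hfv : ∀ x, f x = ∑ e, v e * x e := by
    intro x
    conv_lhs => rw [pi_eq_sum_univ' x]
    rw [map_sum]
    refine Finset.sum_congr rfl fun e _ => ?_
    rw [map_smul, smul_eq_mul, mul_comm]
  obtain ⟨b₀, hb₀⟩ : ∃ b, S.IsWeight b :=
    ⟨_, isWeight_nearPure (S := S) (π := fun _ => 0) (fun a _ => zero_mem_feasible a)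
      (ε := 1 / 2) (by norm_num) (by norm_num)⟩
  set x₀ : UserPair K → ℝ := fun e => S.sharedRate b₀ e - 1 with hx₀
  have hshift : ∀ e (t : ℝ), (0 < lam e → t ≤ 0) → x₀ + t • Pi.single e (1 : ℝ) ∈ G := by
    intro e t ht
    refine ⟨b₀, hb₀, fun e' he' => ?_⟩
    by_cases hee : e' = e
    · subst hee
      have := ht he'
      simp only [hx₀, Pi.add_apply, Pi.smul_apply, Pi.single_eq_same, smul_eq_mul]
      linarith
    · simp [hx₀, hee]
  -- The functional is bounded above on `G` by its value at `lam`, also along each coordinate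
  -- direction that stays in `G`. Downward rays give `v e ≥ 0`; full lines, available where `lam e =
  -- 0`, give `v e = 0`.
  have hline : ∀ e (t : ℝ), (0 < lam e → t ≤ 0) → f x₀ + t * v e < f lam := by
    intro e t ht
    have := hf _ (hshift e t ht)
    rwa [map_add, map_smul, smul_eq_mul] at this
  have hvnonneg : ∀ e, 0 ≤ v e := by
    intro e
    by_contra! hneg
    have h1 := hline e (-(|f lam - f x₀| / (-v e))) fun _ =>
      neg_nonpos.2 (div_nonneg (abs_nonneg _) (by linarith))
    have h2 : -(|f lam - f x₀| / (-v e)) * v e = |f lam - f x₀| := by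
      rw [div_neg, neg_neg, div_mul_cancel₀ _ hneg.ne]
    rw [h2] at h1
    have := le_abs_self (f lam - f x₀)
    linarith
  have hvzero : ∀ e, lam e = 0 → v e = 0 := by
    intro e he
    by_contra hne
    have h1 := hline e ((f lam - f x₀) / v e) fun h => absurd h (by simp [he])
    rw [div_mul_cancel₀ _ hne] at h1
    linarith
  refine ⟨v, hvnonneg, ?_, fun b hb => ?_⟩
  -- Otherwise `v = 0`, against the strict separation of `x₀` from `lam`.
  · by_contra! hall
    have hv0 : ∀ e, v e = 0 := fun e => by
      by_contra hne
      exact hne (hvzero e (le_antisymm (hall e ((hvnonneg e).lt_of_ne' hne)) (h0 e)))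
    have h1 := hf x₀ ⟨b₀, hb₀, fun e _ => by simp [hx₀]⟩
    simp [hfv, hv0] at h1
  · rw [← hfv, ← hfv]
    refine le_of_forall_pos_lt_add fun ε hε => ?_
    have hVpos : 0 ≤ ∑ e, v e := Finset.sum_nonneg fun e _ => hvnonneg e
    -- A shared rate lies only on the boundary of `G`; lowering it by `δ` enters `G` at a cost of at
    -- most `ε`.
    set δ := ε / (∑ e, v e + 1) with hδ
    have hδpos : 0 < δ := by positivity
    have h1 := hf (fun e => S.sharedRate b e - δ) ⟨b, hb, fun e _ => by simpa using hδpos⟩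
    rw [hfv] at h1
    simp only [mul_sub, Finset.sum_sub_distrib, ← Finset.sum_mul] at h1
    have h2 : (∑ e, v e) * δ ≤ ε := by
      rw [hδ, mul_div_assoc', div_le_iff₀ (by positivity)]
      nlinarith
    rw [hfv (fun e => S.sharedRate b e)]
    linarith

theorem usage_mono {π ρ : PairVec K} (h : π ≤ ρ) (j : Fin K) : usage π j ≤ usage ρ j := by
  refine Finset.sum_le_sum fun e _ => ?_
  split_ifs
  · exact h e
  · exact le_rfl

theorem attempts_mem_feasible (hW : S.IsMaxWeight W) (Q : PairVec K) {a : Fin K → ℕ}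
    (ha : a ∈ S.linkStates) : attempts W Q a ∈ feasible a := by
  rw [mem_feasible]
  exact fun j => (usage_mono (fun e => min_le_left _ _) j).trans
    ((mem_feasible _ _).1 (hW Q a ha).1 j)

theorem zero_mem_linkStates : (0 : Fin K → ℕ) ∈ S.linkStates := by
  simp [linkStates]

theorem attempts_zero (hW : S.IsMaxWeight W) (Q : PairVec K) : attempts W Q 0 = 0 := by
  ext e
  have h1 := Fintype.mem_piFinset.1
    (Finset.mem_filter.1 (hW Q 0 (zero_mem_linkStates (S := S))).1).1 e
  have h2 : W Q 0 e = 0 := by simpa using h1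
  simp [attempts, h2]

/-- In a fixed state the policy is a deterministic choice of feasible attempts, hence a limit of the
weights `nearPure` as `ε → 0`. The state `a = 0` drops out because nothing is attempted there. -/
theorem sum_mul_serviceRate_le (hW : S.IsMaxWeight W) (Q : PairVec K) {v lam : UserPair K → ℝ}
    (hv : ∀ e, 0 ≤ v e)
    (hsep : ∀ b, S.IsWeight b → ∑ e, v e * S.sharedRate b e ≤ ∑ e, v e * lam e) :
    ∑ e, v e * S.serviceRate W Q e ≤ ∑ e, v e * lam e := by
  have hπ : ∀ a ∈ S.linkStates, attempts W Q a ∈ feasible a := fun a ha =>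
    attempts_mem_feasible hW Q ha
  have hrate : ∀ e, S.serviceRate W Q e = ∑ a ∈ S.linkStates.filter (fun a => a ≠ 0),
      (S.linkLaw a).toReal * S.Hhat e (attempts W Q a e) := fun e =>
    S.linkMean_eq_sum_filter (by rw [attempts_zero hW]; exact S.Hhat_zero e)
  have hε : ∀ ε ∈ Set.Ioo (0 : ℝ) 1,
      (1 - ε) * ∑ e, v e * S.serviceRate W Q e ≤ ∑ e, v e * lam e := by
    rintro ε ⟨h0, h1⟩
    refine le_trans ?_ (hsep _ (isWeight_nearPure hπ h0 h1))
    rw [Finset.mul_sum]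
    refine Finset.sum_le_sum fun e _ => ?_
    rw [mul_left_comm, hrate]
    exact mul_le_mul_of_nonneg_left (mul_Hhat_le_sharedRate_nearPure hπ h0 h1 e) (hv e)
  have hcont : Tendsto (fun ε : ℝ => (1 - ε) * ∑ e, v e * S.serviceRate W Q e) (𝓝[>] 0)
      (𝓝 ((1 - 0) * ∑ e, v e * S.serviceRate W Q e)) :=
    ((continuous_const.sub continuous_id).mul continuous_const).continuousAt.tendsto.mono_left
      nhdsWithin_le_nhds
  rw [sub_zero, one_mul] at hcont
  refine le_of_tendsto hcont ?_
  filter_upwards [Ioo_mem_nhdsGT (zero_lt_one (α := ℝ))] with ε h using hε ε h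

variable {arr : UserPair K → PMF ℕ}

/-- With positive probability no link-level entanglement is generated and all requests wait. -/
theorem add_mem_support_step (hW : S.IsMaxWeight W) (Q : PairVec K) {A : PairVec K}
    (hA : A ∈ (prodPMF arr).support) : Q + A ∈ (S.step W arr Q).support := by
  rw [step_eq, PMF.mem_support_bind_iff]
  refine ⟨0, S.mem_support_linkLaw.2 zero_mem_linkStates, ?_⟩
  rw [PMF.mem_support_bind_iff]
  obtain ⟨D, hD⟩ := (S.deliveryLaw (attempts W Q 0)).support_nonempty
  refine ⟨D, hD, ?_⟩
  rw [PMF.mem_support_map_iff]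
  refine ⟨A, hA, ?_⟩
  ext e
  have h := S.le_of_mem_support_deliveryLaw hD e
  rw [attempts_zero hW] at h
  have h0 : D e = 0 := by simpa using h
  simp [h0]

/-- Stability is possible only for arrival rates in `Λ^SP`. -/
theorem mem_LambdaSP_of_stable (hW : S.IsMaxWeight W) (harr : FiniteSecondMoments arr)
    (hst : S.Stable W arr) : rate arr ∈ S.LambdaSP := by
  by_contra hlam
  obtain ⟨v, hv0, ⟨e₀, hve, hre⟩, hsep⟩ := exists_separating (rate_nonneg arr) hlam
  obtain ⟨μ, hconv, hmean⟩ := hst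
  have hμ : μ.bind (S.step W arr) = μ := by
    have h := hconv (PMF.pure 0) fun x hx => by
      rw [PMF.mem_support_pure_iff] at hx
      subst hx
      exact admissible_zero arr
    simp only [queueLaw_eq_chainLaw] at h
    exact bind_eq_of_tendsto_toProb h
  set V : PairVec K → ℝ≥0∞ := fun x => ∑ e, ENNReal.ofReal (v e) * (x e : ℝ≥0∞) with hV
  have hfin : expect μ V ≠ ∞ := by
    simp only [hV, expect_finset_sum, expect_const_mul]
    exact ENNReal.sum_ne_top.2 fun e _ => ENNReal.mul_ne_top ENNReal.ofReal_ne_top (hmean e).ne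
  have hofReal : ∀ r : UserPair K → ℝ, (∀ e, 0 ≤ r e) →
      ∑ e, ENNReal.ofReal (v e) * ENNReal.ofReal (r e) = ENNReal.ofReal (∑ e, v e * r e) := by
    intro r hr
    rw [ENNReal.ofReal_sum_of_nonneg fun e _ => mul_nonneg (hv0 e) (hr e)]
    exact Finset.sum_congr rfl fun e _ => (ENNReal.ofReal_mul (hv0 e)).symm
  -- The exact linear drift is the weighted arrival rate minus the weighted service rate, which is
  -- nonnegative by separation.
  have hdrift : ∀ x, V x ≤ expect (S.step W arr x) V := by
    intro x
    have h1 := expect_step_linear_add (S := S) W arr x fun e => ENNReal.ofReal (v e)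
    simp only [expect_arr harr] at h1
    rw [hofReal _ (S.serviceRate_nonneg W x), hofReal _ (rate_nonneg arr)] at h1
    have h2 := ENNReal.ofReal_le_ofReal (sum_mul_serviceRate_le hW x hv0 hsep)
    refine (ENNReal.add_le_add_iff_right
      (ENNReal.ofReal_ne_top (r := ∑ e, v e * rate arr e))).1 ?_
    rw [hV, ← h1]
    gcongr
  obtain ⟨x, hx⟩ := μ.support_nonempty
  obtain ⟨A, hA⟩ : ∃ A ∈ (prodPMF arr).support, 0 < A e₀ := by
    classical
    obtain ⟨k, hk, hkpos⟩ := exists_mem_support_pos_of_rate_pos hre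
    choose B hB using fun e => (arr e).support_nonempty
    refine ⟨Function.update B e₀ k, mem_support_prodPMF.2 fun e => ?_, by simpa using hkpos⟩
    by_cases he : e = e₀
    · subst he
      simpa using hk
    · simpa [he] using hB e
  -- The transition that adds `A` without any delivery would have to preserve `V`, although `A` has
  -- a positive entry where `v` is positive.
  have heq := eq_of_stationary_of_le_expect hμ hfin (fun x _ => hdrift x) x hx (x + A)
    (add_mem_support_step hW x hA.1)
  have hadd : V (x + A) = V x + V A := by
    simp only [hV, Pi.add_apply, Nat.cast_add, mul_add, Finset.sum_add_distrib]
  have hVx : V x ≠ ∞ := ne_top_of_expect_ne_top hfin hx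
  have hVA : V A = 0 := by
    refine (ENNReal.add_right_inj hVx).1 ?_
    rw [← hadd, heq, add_zero]
  have h0 := (Finset.sum_eq_zero_iff.1 hVA) e₀ (Finset.mem_univ _)
  rcases mul_eq_zero.1 h0 with h | h
  · exact absurd (ENNReal.ofReal_eq_zero.1 h) (not_le.2 hve)
  · exact hA.2.ne' (by exact_mod_cast h)

end Switch

/-! ### Poisson arrivals -/

open scoped NNReal

/-- The Poisson law with mean `r`. -/
def poissonLaw (r : ℝ≥0) : PMF ℕ := (ProbabilityTheory.poissonMeasure r).toPMF

theorem poissonLaw_apply (r : ℝ≥0) (n : ℕ) :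
    poissonLaw r n = ENNReal.ofReal (Real.exp (-r) * (r : ℝ) ^ n / (n.factorial : ℝ)) := by
  rw [poissonLaw, Measure.toPMF_apply, ProbabilityTheory.poissonMeasure_singleton]

theorem mem_support_poissonLaw {r : ℝ≥0} (hr : 0 < r) (n : ℕ) : n ∈ (poissonLaw r).support := by
  rw [PMF.mem_support_iff, poissonLaw_apply, ← pos_iff_ne_zero, ENNReal.ofReal_pos]
  have : (0 : ℝ) < r := hr
  positivity

theorem zero_mem_support_poissonLaw (r : ℝ≥0) : 0 ∈ (poissonLaw r).support := by
  rw [PMF.mem_support_iff, poissonLaw_apply, ← pos_iff_ne_zero, ENNReal.ofReal_pos]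
  simp [Real.exp_pos]

theorem poissonLaw_succ_mul (r : ℝ≥0) (n : ℕ) :
    poissonLaw r (n + 1) * ((n + 1 : ℕ) : ℝ≥0∞) = r * poissonLaw r n := by
  rw [poissonLaw_apply, poissonLaw_apply, ← ENNReal.ofReal_natCast,
    ← ENNReal.ofReal_mul (by positivity), ← ENNReal.ofReal_coe_nnreal,
    ← ENNReal.ofReal_mul (by positivity)]
  congr 1
  rw [Nat.factorial_succ]
  push_cast
  field_simp
  ring

/-- The Stein identity of the Poisson law; `g = 1` gives the mean and `g n = n` the second moment.
-/
theorem expect_poissonLaw_mul (r : ℝ≥0) (g : ℕ → ℝ≥0∞) :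
    expect (poissonLaw r) (fun n => (n : ℝ≥0∞) * g n) =
      r * expect (poissonLaw r) fun n => g (n + 1) := by
  rw [expect, tsum_eq_zero_add' ENNReal.summable, expect, ← ENNReal.tsum_mul_left]
  simp only [Nat.cast_zero, zero_mul, mul_zero, zero_add]
  refine tsum_congr fun n => ?_
  rw [← mul_assoc, poissonLaw_succ_mul, mul_assoc]

theorem expect_poissonLaw (r : ℝ≥0) : expect (poissonLaw r) (fun n => (n : ℝ≥0∞)) = r := by
  simpa using expect_poissonLaw_mul r fun _ => 1

theorem expect_poissonLaw_sq_lt_top (r : ℝ≥0) :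
    expect (poissonLaw r) (fun n => (n : ℝ≥0∞) ^ 2) < ∞ := by
  have h := expect_poissonLaw_mul r fun n => (n : ℝ≥0∞)
  simp only [← pow_two, Nat.cast_add, Nat.cast_one, expect_add, expect_const,
    expect_poissonLaw] at h
  rw [h]
  exact ENNReal.mul_lt_top ENNReal.coe_lt_top (by simp)

theorem mem_support_chainLaw_succ {α : Type*} {κ : α → PMF α} {x y z : α} {n : ℕ}
    (hy : y ∈ (κ x).support) (hz : z ∈ (chainLaw κ (PMF.pure y) n).support) :
    z ∈ (chainLaw κ (PMF.pure x) (n + 1)).support := by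
  rw [add_comm, chainLaw_add, chainLaw_bind, PMF.mem_support_bind_iff]
  exact ⟨y, by simpa [chainLaw] using hy, hz⟩

/-! ### Existence of essentially irreducible arrivals for each rate in `Λ^SP` -/

namespace Switch

variable {K : ℕ} {S : Switch K} {W : Policy K}

/-- Arrivals whose laws charge all natural numbers, or only zero, make the chain of queue lengths
essentially irreducible when their rate vector is in `Λ^SP`. -/
theorem essentiallyIrreducible_of_full_support {arr : UserPair K → PMF ℕ}
    (hW : S.IsMaxWeight W) (harr : FiniteSecondMoments arr) (hlam : rate arr ∈ S.LambdaSP)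
    (hzero : ∀ e, 0 ∈ (arr e).support)
    (hfull : ∀ e, arr e ≠ PMF.pure 0 → ∀ n, n ∈ (arr e).support) :
    S.EssentiallyIrreducible W arr := by
  classical
  obtain ⟨η, c, hη0, -, hc, hdrift⟩ := exists_drift hW harr hlam
  have hF : {x : PairVec K | η * ∑ e, (x e : ℝ≥0∞) ≤ c}.Finite := finite_setOf_sum_le hη0 hc
  set F := hF.toFinset.filter fun x : PairVec K => Admissible arr x with hFdef
  have hmemF : ∀ x, x ∈ F ↔ η * ∑ e, (x e : ℝ≥0∞) ≤ c ∧ Admissible arr x := fun x => by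
    simp [hFdef]
  -- As `z` dominates the finite set `F`, each state of `F` reaches it in one slot without service,
  -- with arrivals `z - x`; arrivals 0 keep the chain at `z`.
  set z : PairVec K := F.sup id with hz
  have hzadm : Admissible arr z := by
    intro e he
    refine Nat.eq_zero_of_le_zero ?_
    have h : z ≤ fun e' => if e' = e then 0 else z e' := by
      refine Finset.sup_le fun x hx e' => ?_
      by_cases hee : e' = e
      · subst hee
        simp [((hmemF x).1 hx).2 e' he]
      · simp only [id, hee, if_false]
        exact Finset.le_sup (f := id) hx e'
    simpa using h e
  have hjump : ∀ x, x ≤ z → z ∈ (S.step W arr x).support := by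
    intro x hxz
    have h := add_mem_support_step (S := S) (arr := arr) hW x (A := z - x)
      (mem_support_prodPMF.2 fun e => ?_)
    · rwa [add_tsub_cancel_of_le hxz] at h
    · by_cases he : arr e = PMF.pure 0
      · simpa [hzadm e he] using hzero e
      · exact hfull e he _
  have hstay : ∀ n, z ∈ (chainLaw (S.step W arr) (PMF.pure z) n).support := by
    intro n
    induction n with
    | zero => simp [chainLaw]
    | succ n ih => exact mem_support_chainLaw_succ (hjump z le_rfl) ih
  -- Descent on the sum of squares: outside `F` its mean strictly decreases, so some possible
  -- successor has a strictly smaller value.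
  have hreach : ∀ m : ℕ, ∀ x, Admissible arr x → ∑ e, x e ^ 2 ≤ m →
      ∃ N, ∀ n, z ∈ (chainLaw (S.step W arr) (PMF.pure x) (N + n)).support := by
    intro m
    induction m using Nat.strong_induction_on with
    | _ m ih =>
      intro x hx hxm
      by_cases hxF : x ∈ F
      · refine ⟨1, fun n => ?_⟩
        rw [add_comm]
        exact mem_support_chainLaw_succ (hjump x (Finset.le_sup (f := id) hxF)) (hstay n)
      · have hlt : c < η * ∑ e, (x e : ℝ≥0∞) := by
          by_contra! hle
          exact hxF ((hmemF x).2 ⟨hle, hx⟩)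
        have hsq : ∑ e, (x e : ℝ≥0∞) ^ 2 ≠ ∞ :=
          ENNReal.sum_ne_top.2 fun e _ => ENNReal.pow_ne_top (ENNReal.natCast_ne_top _)
        have hdec : expect (S.step W arr x) (fun y => ∑ e, (y e : ℝ≥0∞) ^ 2) <
            ∑ e, (x e : ℝ≥0∞) ^ 2 := by
          by_contra! hge
          have h1 := (add_le_add_left hge (η * ∑ e, (x e : ℝ≥0∞))).trans (hdrift x hx)
          exact absurd ((ENNReal.add_le_add_iff_left hsq).1 h1) (not_le.2 hlt)
        obtain ⟨y, hy, hyx⟩ := exists_support_lt hdec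
        have hyx' : ∑ e, y e ^ 2 < ∑ e, x e ^ 2 := by exact_mod_cast hyx
        obtain ⟨N, hN⟩ := ih _ (hyx'.trans_le hxm) y
          (isClosedSet_admissible W arr x hx hy) le_rfl
        refine ⟨N + 1, fun n => ?_⟩
        rw [add_right_comm]
        exact mem_support_chainLaw_succ hy (hN n)
  refine ⟨z, fun x hx => ?_⟩
  obtain ⟨N, hN⟩ := hreach _ x hx le_rfl
  filter_upwards [eventually_ge_atTop N] with n hn
  rw [queueLaw_eq_chainLaw]
  have := hN (n - N)
  rwa [Nat.add_sub_cancel' hn] at this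

/-- Poisson laws of positive mean charge every natural number, and a Poisson law of mean zero is the
point mass at 0. -/
theorem exists_arrivals {lam : UserPair K → ℝ} (hW : S.IsMaxWeight W) (hlam : lam ∈ S.LambdaSP) :
    ∃ arr : UserPair K → PMF ℕ, FiniteSecondMoments arr ∧ rate arr = lam ∧
      S.EssentiallyIrreducible W arr := by
  set arr : UserPair K → PMF ℕ := fun e => poissonLaw (lam e).toNNReal with harrdef
  have harr : FiniteSecondMoments arr := fun e => expect_poissonLaw_sq_lt_top _
  have hrate : rate arr = lam := by
    ext e
    rw [rate_eq_toReal, expect_poissonLaw, ENNReal.coe_toReal,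
      Real.coe_toNNReal _ (hlam.1 e)]
  refine ⟨arr, harr, hrate, essentiallyIrreducible_of_full_support hW harr (hrate ▸ hlam)
    (fun e => zero_mem_support_poissonLaw _) fun e he n => mem_support_poissonLaw ?_ n⟩
  by_contra hle
  refine he (eq_pure_zero_of_rate_eq_zero harr ?_)
  rw [hrate]
  exact le_antisymm (not_lt.1 fun h => hle (Real.toNNReal_pos.2 h)) (hlam.1 e)

end Switch

end QuantumSwitch

end

/-! ### The stability criterion and the capacity region -/

theorem theorem4 {K : ℕ} (S : QuantumSwitch.Switch K) (W : QuantumSwitch.Policy K)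
    (hW : S.IsMaxWeight W) :
    (∀ arr : QuantumSwitch.UserPair K → PMF ℕ, QuantumSwitch.FiniteSecondMoments arr →
      S.EssentiallyIrreducible W arr →
      (S.Stable W arr ↔ QuantumSwitch.rate arr ∈ S.LambdaSP)) ∧
    S.capacityRegion W = S.LambdaSP := by
  have hiff : ∀ arr : QuantumSwitch.UserPair K → PMF ℕ, QuantumSwitch.FiniteSecondMoments arr →
      S.EssentiallyIrreducible W arr →
      (S.Stable W arr ↔ QuantumSwitch.rate arr ∈ S.LambdaSP) := fun arr harr hirr =>
    ⟨QuantumSwitch.Switch.mem_LambdaSP_of_stable hW harr,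
      QuantumSwitch.Switch.stable_of_mem_LambdaSP hW harr hirr⟩
  refine ⟨hiff, Set.Subset.antisymm ?_ fun lam hlam => ?_⟩
  -- The arrivals whose existence is part of the definition of the capacity region are the ones to
  -- which the criterion is applied.
  · rintro lam ⟨⟨arr, harr, rfl, hirr⟩, hall⟩
    exact (hiff arr harr hirr).1 (hall arr harr rfl hirr)
  · refine ⟨QuantumSwitch.Switch.exists_arrivals hW hlam, ?_⟩
    rintro arr harr rfl hirr
    exact (hiff arr harr hirr).2 hlam
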